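/- **State Transition Type Safety (act language).** Let $\Sigma$ be a well-typed state typing and let $s, s'$ be states with $\Sigma\vdash s\rightsquigarrow^* s'$ (zero or more constructor or transition steps). Then - for all values $v$ and slot types $\sigma$: if $\Sigma\vdash v:_s\sigma$ then $\Sigma\vdash v:_{s'}\sigma$; - $\mathrm{dom}(s)\subseteq\mathrm{dom}(s')$. The state $s$ is arbitrary; it need not be reachable from the empty state. The notions used are the following. *Types.* Integer types $\iota$: $\mathtt{uint}M$, $\mathtt{int}M$ ($M\in\{8,16,\dots,256\}$) and the unbounded $\mathtt{int}$. Base types $\beta::=\iota\mid\mathtt{bool}\mid\mathtt{address}$; mapping types $\mu::=\mathtt{mapping}(\beta,\mu)\mid\beta$; ABI types $\alpha::=\beta\mid\mathtt{address}_A$; slot types $\sigma::=\mu\mid\alpha\mid A$, where $A$ is a contract name. *Values and states.* $\mathrm{Addr}=\mathbb N$. Base values are the elements of $\mathbb Z+\mathbb B+\mathrm{Addr}$; values are base values and functions from $\mathbb Z$, $\mathbb B$ or $\mathrm{Addr}$ to values. A state is a finite partial map sending an address $\ell$ to a contract type $s(\ell).\mathtt{type}$ and a partial map $x\mapsto s(\ell)(x)$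 from field names to values. An environment $\rho$ is a partial map from identifiers and the keywords $\mathtt{caller},\mathtt{origin},\mathtt{callvalue}$ (which are not identifiers) to base values. *State typings.* $\Sigma$ assigns to contract names $A$ (partially) a storage typing $\Sigma_{\rm Storage}(A)$, i.e. a partial map from fields to slot types, a constructor $\Sigma_{\rm Cnstr}(A)$ and a list of transitions $\Sigma_{\rm Trans}(A)$. A constructor has an interface $I=(x_1:\alpha_1,\dots,x_n:\alpha_n)$, preconditions, and a nonempty list of cases, each a condition with a list of assignments $\sigma\;x:=se$; a transition has an interface, preconditions, and cases, each a condition with a list of updates $\mathit{ref}:=se$ and an optional return expression. Both also have postconditions and a payable flag. *Value typing.* $\vdash v:\beta$ says that $v$ is an address, a boolean, or an integer in the range of $\iota$; $\vdash f:\mathtt{mapping}(\beta,\mu)$ says that $f$ is a function on the domain of $\beta$ ($\mathbb Z$, $\mathbb B$ or $\mathrm{Addr}$) with $\vdash f(v):\mu$ whenever $\vdash v:\beta$. $\Sigma\vdash v:_s\sigma$ is the least relation such that: $\Sigma\vdash v:_s\mu$ if $\vdash v:\mu$; $\Sigma\vdash\ell:_s\mathtt{address}_A$ if $\ell\in\mathrm{dom}(s)$,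 $A\in\mathrm{dom}(\Sigma_{\rm Storage})$, $s(\ell).\mathtt{type}=A$, the fields of $s(\ell)$ are exactly those of $\Sigma_{\rm Storage}(A)$, and $\Sigma\vdash s(\ell)(x):_s\Sigma_{\rm Storage}(A)(x)$ for every such field $x$; $\Sigma\vdash\ell:_s A$ if $\Sigma\vdash\ell:_s\mathtt{address}_A$. $\Sigma\vdash\rho:_sI$ says that $\rho$ is defined exactly on the variables of $I$ and the three keywords, its values at the variables have their types in $I$, and $\mathtt{caller},\mathtt{origin}$ have type $\mathtt{address}$, $\mathtt{callvalue}$ type $\mathtt{uint256}$. *Steps.* $\Sigma\vdash s\rightsquigarrow s'$ holds if, for some $A,\ell,\rho$, either (constructor) $\Sigma_{\rm Cnstr}(A)=c$, $\Sigma\vdash\rho:_s I_c$ and $s;\rho;c\Downarrow_A(\ell,s')$; or (transition) $\Sigma\vdash\ell:_sA$, $t\in\Sigma_{\rm Trans}(A)$, $\Sigma\vdash\rho:_sI_t$ and $s;\rho;t\Downarrow_\ell(v,s')$ for some $v$. Here $\Downarrow$ is the big-step pointer semantics of act: all preconditions evaluate to true, exactly one case condition evaluates to true and the others to false, and the body of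 that case is executed. The body of a constructor case evaluates its slot expressions from left to right, threading the state, and allocates at $\max(\mathrm{dom})+1$ an instance of type $A$ with the resulting values; constructor code runs at a dummy location (address $0$). The body of a transition case evaluates all right-hand sides from left to right, then performs the field assignments one after the other (each reference being evaluated in the then current state), and evaluates the return expression, if any, in the pair (pre-state, post-state). Slot expressions are mapping expressions, references, $\mathrm{addr}(se)$, and $\mathtt{new}\,A(\dots)$ or $\mathtt{new}\,A\{\mathtt{value}:se\}(\dots)$, which run the cases of the constructor $\Sigma_{\rm Cnstr}(A)$ with the evaluated arguments, the current location as caller, the same origin, and call value $0$ or the given value. *Well-typed $\Sigma$.* The least predicate such that $\Sigma$ is well-typed if $\mathrm{dom}(\Sigma_{\rm Storage})=\mathrm{dom}(\Sigma_{\rm Cnstr})$; for each $A\in\mathrm{dom}(\Sigma_{\rm Cnstr})$ there is a well-typed $\Sigma'\subsetneq\Sigma$ with $\Sigma'\vdash_A\Sigma_{\rm Cnstr}(A):\Sigma_{\rm Storage}(A)$; and for each $A\in\mathrm{dom}(\Sigma_{\rm Trans})$ there is a well-typed $\Sigma'\subsetneq\Sigma$ with $\Sigma'\vdash_At$ for all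 $t\in\Sigma_{\rm Trans}(A)$. These are the typing judgments of act for constructors and transitions: interface types are well-formed (refer only to contracts of $\Sigma'$); preconditions, case conditions and postconditions are boolean; the preconditions entail that exactly one case condition holds; each constructor case creates precisely the fields of the storage typing, disjoint from the interface variables, with well-formed types and including $\mathtt{balance}:\mathtt{uint256}$, each from a slot expression of the declared type; each update assigns a slot expression of type $\sigma$ to a reference of type $\sigma$ that is reachable from the contract's own storage by field accesses without coercion, and no update is preceded by one of a strictly more specific reference; return expressions have the return type. Slot expressions are typed assuming the preconditions and the condition of their case; the typing of integer operations and conversions, and of $\mathtt{new}$, requires range conditions and constructor preconditions, respectively, to hold in every configuration $(s,\rho,\ell)$ that is well-typed under $\Sigma'$ and satisfies these assumptions. -/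

import Mathlib

namespace Act

/-! ### Identifiers, types, values, states -/

/-- Names of variables, of storage fields and of contracts. -/
abbrev Ident := String

/-- The reserved field name `balance`, written through its character codes. -/
def balanceName : Ident := String.ofList ([98, 97, 108, 97, 110, 99, 101].map Char.ofNat)

/-- Bit widths `8, 16, …, 256`. -/
def Width := {m : ℕ // ∃ i : ℕ, 1 ≤ i ∧ i ≤ 32 ∧ m = i * 8}

/-- Integer types: `uintM`, `intM` and the unbounded type `int`. -/
inductive IntType
  | uint (M : Width)
  | sint (M : Width)
  | unbounded

inductive BaseType
  | int (ι : IntType)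
  | bool
  | address

def BaseType.uint256 : BaseType := .int (.uint ⟨256, 32, by norm_num, by norm_num, by norm_num⟩)

inductive MapType
  | base (β : BaseType)
  | mapping (β : BaseType) (μ : MapType)

/-- ABI types: a base type or `address_A`. -/
inductive ABIType
  | base (β : BaseType)
  | contractAddr (A : Ident)

/-- Slot types: mapping types `μ`, ABI types `α`, and contract types `A`. A base type is both a
mapping type and an ABI type; it has the single representation `map (base β)`. -/
inductive SlotType
  | map (μ : MapType)
  | contractAddr (A : Ident)
  | contract (A : Ident)

def ABIType.toSlot : ABIType → SlotType
  | .base β => .map (.base β)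
  | .contractAddr A => .contractAddr A

abbrev Addr := ℕ

inductive BaseValue
  | int (n : ℤ)
  | bool (b : Bool)
  | addr (l : Addr)
  deriving DecidableEq

inductive Value
  | base (b : BaseValue)
  | mapInt (f : ℤ → Value)
  | mapBool (f : Bool → Value)
  | mapAddr (f : Addr → Value)

/-- A contract instance: its contract type and its storage. -/
structure Obj where
  type : Ident
  store : Ident → Option Value

/-- States: partial maps from addresses to contract instances, of finite domain. -/
abbrev State := Finmap (fun _ : Addr => Obj)

/-- `fresh s = max (dom s) + 1`, with `max ∅ = 0`. -/
def fresh (s : State) : Addr := s.keys.sup id + 1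

/-- The keys of an environment: identifiers and the three keywords, which are not identifiers. -/
inductive EnvKey
  | var (x : Ident)
  | caller
  | origin
  | callvalue

abbrev Env := EnvKey → Option BaseValue

/-- `v` lies in the integer type `ι`. -/
def IntType.InRange : IntType → ℤ → Prop
  | .uint M, v => 0 ≤ v ∧ v ≤ 2 ^ M.val - 1
  | .sint M, v => -2 ^ (M.val - 1) ≤ v ∧ v ≤ 2 ^ (M.val - 1) - 1
  | .unbounded, _ => True

/-- Membership of a base value in `meta β`, which is `ℤ`, `𝔹` or `Addr`. -/
def BaseValue.InMeta : BaseType → BaseValue → Prop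
  | .int _, .int _ => True
  | .bool, .bool _ => True
  | .address, .addr _ => True
  | _, _ => False

/-- `v ∈ meta β → Value`. -/
def Value.IsMap : BaseType → Value → Prop
  | .int _, .mapInt _ => True
  | .bool, .mapBool _ => True
  | .address, .mapAddr _ => True
  | _, _ => False

/-- Application of a mapping value to a key, defined when the key lies in its domain. -/
def Value.app : Value → BaseValue → Option Value
  | .mapInt f, .int n => some (f n)
  | .mapBool f, .bool b => some (f b)
  | .mapAddr f, .addr l => some (f l)
  | _, _ => none

/-- The restriction of `f` to `meta β`, as a mapping value. -/
def Value.ofFun : BaseType → (BaseValue → Value) → Value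
  | .int _, f => .mapInt fun n => f (.int n)
  | .bool, f => .mapBool fun b => f (.bool b)
  | .address, f => .mapAddr fun l => f (.addr l)

def defaultValue : MapType → Value
  | .base (.int _) => .base (.int 0)
  | .base .bool => .base (.bool false)
  | .base .address => .base (.addr 0)
  | .mapping β μ => .ofFun β fun _ => defaultValue μ

/-! ### Syntax -/

inductive IntOp
  | add | sub | mul | div | mod | exp

inductive BoolOp
  | and | or | imp

inductive CmpOp
  | lt | le | ge | gt

inductive EnvVar
  | caller | origin | callvalue | this

mutual

/-- Variable references. -/
inductive Ref
  | var (x : Ident)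
  | pre (x : Ident)
  | post (x : Ident)
  | coerce (r : Ref) (A : Ident)
  | field (r : Ref) (x : Ident)
  | index (r : Ref) (e : Expr)
  | env (v : EnvVar)

/-- Base expressions. References carry their type annotation. -/
inductive Expr
  | int (n : ℤ)
  | bool (b : Bool)
  | ref (r : Ref) (α : ABIType)
  | addr (r : Ref) (A : Ident)
  | iop (op : IntOp) (e₁ e₂ : Expr)
  | bop (op : BoolOp) (e₁ e₂ : Expr)
  | cmp (op : CmpOp) (e₁ e₂ : Expr)
  | not (e : Expr)
  | inrange (ι : IntType) (e : Expr)
  | ite (e₁ e₂ e₃ : Expr)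
  | eq (e₁ e₂ : Expr)

end

/-- Mapping expressions. The annotations `β`, `μ` stand for the type `mapping(β, μ)`. -/
inductive MapExpr
  | exp (e : Expr)
  | map (kvs : List (Expr × MapExpr)) (β : BaseType) (μ : MapType)
  | upd (r : Ref) (kvs : List (Expr × MapExpr)) (β : BaseType) (μ : MapType)

/-- Slot expressions. `new A ses` and `newPayable A se ses` are `new A(ses)` and
`new A{value: se}(ses)`. -/
inductive SlotExpr
  | map (m : MapExpr)
  | new (A : Ident) (ses : List SlotExpr)
  | newPayable (A : Ident) (val : SlotExpr) (ses : List SlotExpr)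
  | ref (r : Ref) (A : Ident)
  | addr (se : SlotExpr)

/-- Interfaces `x₁ : α₁, …, xₙ : αₙ`; as a map, `I(x)` is `I.lookup x`. -/
abbrev Iface := List (Ident × ABIType)

/-- `σ x := se` in a constructor. -/
structure Create where
  type : SlotType
  name : Ident
  rhs : SlotExpr

/-- `ref_σ := se` in a transition. -/
structure Update where
  ref : Ref
  type : SlotType
  rhs : SlotExpr

structure CtorCase where
  cond : Expr
  creates : List Create

structure Constructor where
  iface : Iface
  payable : Bool
  pre : List Expr
  cases : List CtorCase
  post : List Expr

structure TransCase where
  cond : Expr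
  updates : List Update
  ret : Option Expr

structure Transition where
  name : Ident
  iface : Iface
  payable : Bool
  retType : Option ABIType
  pre : List Expr
  cases : List TransCase
  post : List Expr

/-- Storage typings `C` of a contract. -/
abbrev Storage := Ident → Option SlotType

/-- State typings `Σ`: storage typing, constructor and transitions of each declared contract. -/
@[ext]
structure StateTyping where
  storage : Ident → Option Storage
  cnstr : Ident → Option Constructor
  trans : Ident → Option (List Transition)

/-- `Σ' ⊆ Σ`. -/
def StateTyping.Sub (G' G : StateTyping) : Prop :=
  (∀ A C, G'.storage A = some C → G.storage A = some C) ∧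
  (∀ A c, G'.cnstr A = some c → G.cnstr A = some c) ∧
  (∀ A ts, G'.trans A = some ts → G.trans A = some ts)

/-- `Σ' ⊂ Σ`. -/
def StateTyping.SSub (G' G : StateTyping) : Prop := G'.Sub G ∧ G' ≠ G

/-- `Σ with {Storage = (Σ_Storage, A : C)}`. -/
def StateTyping.addStorage (G : StateTyping) (A : Ident) (C : Storage) : StateTyping :=
  { G with storage := Function.update G.storage A (some C) }

/-! ### Pointer semantics -/

/-- States annotated with a tag: a single state (untimed) or a pair of a pre-state and a
post-state (timed). -/
inductive TState
  | U (s : State)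
  | T (pre post : State)

/-- Timing of an evaluated reference. -/
inductive Timing
  | U | pre | post

/-- The dummy location `·`, used in place of the current location in constructors. -/
def noLoc : Addr := 0

/-- `ρ ; env ⇓_ℓ v` -/
inductive EvalEnv (ρ : Env) (l : Addr) : EnvVar → BaseValue → Prop
  | caller {b} : ρ .caller = some b → EvalEnv ρ l .caller b
  | origin {b} : ρ .origin = some b → EvalEnv ρ l .origin b
  | callvalue {b} : ρ .callvalue = some b → EvalEnv ρ l .callvalue b
  | this : EvalEnv ρ l .this (.addr l)

/-- Reading a storage field: `l ∈ dom s`, `x ∈ dom s(l)` and `s(l)(x) = v`. -/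
def Reads (s : State) (l : Addr) (x : Ident) (v : Value) : Prop :=
  ∃ o, s.lookup l = some o ∧ o.store x = some v

/-- Integer operators other than `div` and `mod`; `exp` has no integer value at a negative
exponent. -/
def IntOp.eval : IntOp → ℤ → ℤ → Option ℤ
  | .add, a, b => some (a + b)
  | .sub, a, b => some (a - b)
  | .mul, a, b => some (a * b)
  | .exp, a, b => if 0 ≤ b then some (a ^ b.toNat) else none
  | .div, _, _ => none
  | .mod, _, _ => none

def BoolOp.eval : BoolOp → Bool → Bool → Bool
  | .and, a, b => a && b
  | .or, a, b => a || b
  | .imp, a, b => !a || b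

def CmpOp.eval : CmpOp → ℤ → ℤ → Bool
  | .lt, a, b => decide (a < b)
  | .le, a, b => decide (a ≤ b)
  | .ge, a, b => decide (a ≥ b)
  | .gt, a, b => decide (a > b)

abbrev Value.int (n : ℤ) : Value := .base (.int n)

abbrev Value.bool (b : Bool) : Value := .base (.bool b)

mutual

/-- `s^t ; ρ ; ref ⇓_ℓ (v, t_p)` -/
inductive EvalRef : TState → Env → Addr → Ref → Value → Timing → Prop
  | env {st ρ l ev b} : EvalEnv ρ l ev b → EvalRef st ρ l (.env ev) (.base b) .U
  | storage {s ρ l x v} : Reads s l x v → ρ (.var x) = none →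
      EvalRef (.U s) ρ l (.var x) v .U
  | storagePre {s s' ρ l x v} : Reads s l x v → ρ (.var x) = none →
      EvalRef (.T s s') ρ l (.pre x) v .pre
  | storagePost {s s' ρ l x v} : Reads s' l x v → ρ (.var x) = none →
      EvalRef (.T s s') ρ l (.post x) v .post
  | calldata {s ρ l x b} : ρ (.var x) = some b →
      EvalRef (.U s) ρ l (.var x) (.base b) .U
  | calldataTimed {s s' ρ l x b} : ρ (.var x) = some b →
      EvalRef (.T s s') ρ l (.var x) (.base b) .pre
  | coerce {st ρ l r A v t} : EvalRef st ρ l r v t → EvalRef st ρ l (.coerce r A) v t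
  | field {s ρ l r x l' v} : EvalRef (.U s) ρ l r (.base (.addr l')) .U → Reads s l' x v →
      EvalRef (.U s) ρ l (.field r x) v .U
  | fieldPre {s s' ρ l r x l' v} :
      EvalRef (.T s s') ρ l r (.base (.addr l')) .pre → Reads s l' x v →
      EvalRef (.T s s') ρ l (.field r x) v .pre
  | fieldPost {s s' ρ l r x l' v} :
      EvalRef (.T s s') ρ l r (.base (.addr l')) .post → Reads s' l' x v →
      EvalRef (.T s s') ρ l (.field r x) v .post
  | index {st ρ l r e b f v t} : EvalExpr st ρ l e (.base b) → EvalRef st ρ l r f t →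
      f.app b = some v → EvalRef st ρ l (.index r e) v t

/-- `s ; ρ ; e ⇓_ℓ v` -/
inductive EvalExpr : TState → Env → Addr → Expr → Value → Prop
  | int {st ρ l n} : EvalExpr st ρ l (.int n) (.int n)
  | bool {st ρ l b} : EvalExpr st ρ l (.bool b) (.bool b)
  | ref {st ρ l r α v t} : EvalRef st ρ l r v t → EvalExpr st ρ l (.ref r α) v
  | addr {st ρ l r A v t} : EvalRef st ρ l r v t → EvalExpr st ρ l (.addr r A) v
  | rangeTrue {st ρ l ι e n} : EvalExpr st ρ l e (.int n) → ι.InRange n →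
      EvalExpr st ρ l (.inrange ι e) (.bool true)
  | rangeFalse {st ρ l ι e n} : EvalExpr st ρ l e (.int n) → ¬ ι.InRange n →
      EvalExpr st ρ l (.inrange ι e) (.bool false)
  | div {st ρ l e₁ e₂ m n} : EvalExpr st ρ l e₁ (.int m) → EvalExpr st ρ l e₂ (.int n) → n ≠ 0 →
      EvalExpr st ρ l (.iop .div e₁ e₂) (.int (m.tdiv n))
  | divZero {st ρ l e₁ e₂ m} : EvalExpr st ρ l e₁ (.int m) → EvalExpr st ρ l e₂ (.int 0) →
      EvalExpr st ρ l (.iop .div e₁ e₂) (.int 0)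
  | mod {st ρ l e₁ e₂ m n} : EvalExpr st ρ l e₁ (.int m) → EvalExpr st ρ l e₂ (.int n) → n ≠ 0 →
      EvalExpr st ρ l (.iop .mod e₁ e₂) (.int (m.tmod n))
  | modZero {st ρ l e₁ e₂ m} : EvalExpr st ρ l e₁ (.int m) → EvalExpr st ρ l e₂ (.int 0) →
      EvalExpr st ρ l (.iop .mod e₁ e₂) (.int 0)
  | iop {st ρ l op e₁ e₂ m n k} : EvalExpr st ρ l e₁ (.int m) → EvalExpr st ρ l e₂ (.int n) →
      op.eval m n = some k → EvalExpr st ρ l (.iop op e₁ e₂) (.int k)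
  | bop {st ρ l op e₁ e₂ a b} : EvalExpr st ρ l e₁ (.bool a) → EvalExpr st ρ l e₂ (.bool b) →
      EvalExpr st ρ l (.bop op e₁ e₂) (.bool (op.eval a b))
  | not {st ρ l e b} : EvalExpr st ρ l e (.bool b) → EvalExpr st ρ l (.not e) (.bool (!b))
  | cmp {st ρ l op e₁ e₂ m n} : EvalExpr st ρ l e₁ (.int m) → EvalExpr st ρ l e₂ (.int n) →
      EvalExpr st ρ l (.cmp op e₁ e₂) (.bool (op.eval m n))
  | iteTrue {st ρ l e₁ e₂ e₃ v} : EvalExpr st ρ l e₁ (.bool true) → EvalExpr st ρ l e₂ v →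
      EvalExpr st ρ l (.ite e₁ e₂ e₃) v
  | iteFalse {st ρ l e₁ e₂ e₃ v} : EvalExpr st ρ l e₁ (.bool false) → EvalExpr st ρ l e₃ v →
      EvalExpr st ρ l (.ite e₁ e₂ e₃) v
  | eqTrue {st ρ l e₁ e₂ v₁ v₂} : EvalExpr st ρ l e₁ v₁ → EvalExpr st ρ l e₂ v₂ → v₁ = v₂ →
      EvalExpr st ρ l (.eq e₁ e₂) (.bool true)
  | eqFalse {st ρ l e₁ e₂ v₁ v₂} : EvalExpr st ρ l e₁ v₁ → EvalExpr st ρ l e₂ v₂ → v₁ ≠ v₂ →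
      EvalExpr st ρ l (.eq e₁ e₂) (.bool false)

end

mutual

/-- `s ; ρ ; m ⇓_ℓ v`. If a key occurs twice in a mapping literal, its first occurrence counts. -/
inductive EvalMap : TState → Env → Addr → MapExpr → Value → Prop
  | exp {st ρ l e v} : EvalExpr st ρ l e v → EvalMap st ρ l (.exp e) v
  | map {st ρ l kvs β μ us} : EvalEntries st ρ l kvs us → (∀ p ∈ us, p.1.InMeta β) →
      EvalMap st ρ l (.map kvs β μ)
        (.ofFun β fun x => (us.lookup x).getD (defaultValue μ))
  | upd {st ρ l r kvs β μ us f t g} : EvalRef st ρ l r f t → f.IsMap β →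
      EvalEntries st ρ l kvs us → (∀ p ∈ us, p.1.InMeta β) →
      (∀ x u, f.app x = some u → g x = (us.lookup x).getD u) →
      EvalMap st ρ l (.upd r kvs β μ) (.ofFun β g)

/-- Evaluation of the entries `eᵢ ⇒ mᵢ` of a mapping literal to pairs `(vᵢ, uᵢ)`. -/
inductive EvalEntries :
    TState → Env → Addr → List (Expr × MapExpr) → List (BaseValue × Value) → Prop
  | nil {st ρ l} : EvalEntries st ρ l [] []
  | cons {st ρ l e m kvs b u us} : EvalExpr st ρ l e (.base b) → EvalMap st ρ l m u →
      EvalEntries st ρ l kvs us → EvalEntries st ρ l ((e, m) :: kvs) ((b, u) :: us)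

end

/-- The partial map `{x₁ ↦ v₁, …, xₙ ↦ vₙ}`. -/
def assign {V : Type} (xs : List Ident) (vs : List V) (x : Ident) : Option V :=
  (xs.zip vs).lookup x

/-- The environment `{xᵢ ↦ vᵢ}`, without values for the keywords. -/
def argEnv (I : Iface) (bs : List BaseValue) : Env
  | .var x => assign (I.map Prod.fst) bs x
  | _ => none

/-- The environment `{xᵢ ↦ vᵢ} ∪ {caller ↦ c, origin ↦ o, callvalue ↦ w}`. -/
def callEnv (I : Iface) (bs : List BaseValue) (c o w : BaseValue) : Env
  | .var x => assign (I.map Prod.fst) bs x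
  | .caller => some c
  | .origin => some o
  | .callvalue => some w

mutual

/-- `s ; ρ ; se ⇓_ℓ (v, s')`, where constructors are looked up in `G`. -/
inductive EvalSlot (G : StateTyping) :
    State → Env → Addr → SlotExpr → Value → State → Prop
  | map {s ρ l m v} : EvalMap (.U s) ρ l m v → EvalSlot G s ρ l (.map m) v s
  | ref {s ρ l r A v t} : EvalRef (.U s) ρ l r v t → EvalSlot G s ρ l (.ref r A) v s
  | addr {s ρ l se v s'} : EvalSlot G s ρ l se v s' → EvalSlot G s ρ l (.addr se) v s'
  | new {s ρ l A ses ctor bs sₙ o l' s'} : G.cnstr A = some ctor → ctor.payable = false →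
      ctor.iface.length = ses.length →
      EvalSlots G s ρ l ses (bs.map .base) sₙ →
      ρ .origin = some o →
      EvalCtorCases G sₙ (callEnv ctor.iface bs (.addr l) o (.int 0)) ctor.cases A l' s' →
      EvalSlot G s ρ l (.new A ses) (.base (.addr l')) s'
  | newPayable {s ρ l A val ses ctor bs w sₙ sₘ o l' s'} :
      G.cnstr A = some ctor → ctor.payable = true →
      ctor.iface.length = ses.length →
      EvalSlots G s ρ l ses (bs.map .base) sₙ →
      EvalSlot G sₙ ρ l val (.base w) sₘ →
      ρ .origin = some o →
      EvalCtorCases G sₘ (callEnv ctor.iface bs (.addr l) o w) ctor.cases A l' s' →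
      EvalSlot G s ρ l (.newPayable A val ses) (.base (.addr l')) s'

/-- Evaluation of `se₁, …, seₙ` from left to right, threading the state. -/
inductive EvalSlots (G : StateTyping) :
    State → Env → Addr → List SlotExpr → List Value → State → Prop
  | nil {s ρ l} : EvalSlots G s ρ l [] [] s
  | cons {s ρ l se ses v vs s' s''} : EvalSlot G s ρ l se v s' →
      EvalSlots G s' ρ l ses vs s'' → EvalSlots G s ρ l (se :: ses) (v :: vs) s''

/-- `s ; ρ ; creates ⇓_A (ℓ, s')` -/
inductive EvalCreates (G : StateTyping) :
    State → Env → List Create → Ident → Addr → State → Prop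
  | mk {s ρ cs A vs sₙ} : EvalSlots G s ρ noLoc (cs.map Create.rhs) vs sₙ →
      EvalCreates G s ρ cs A (fresh sₙ)
        (sₙ.insert (fresh sₙ) ⟨A, assign (cs.map Create.name) vs⟩)

/-- `s ; ρ ; ccases ⇓_A (ℓ, s')` -/
inductive EvalCtorCases (G : StateTyping) :
    State → Env → List CtorCase → Ident → Addr → State → Prop
  | mk {s ρ A l s'} {cases : List CtorCase} {j : ℕ} {c : CtorCase} : cases[j]? = some c →
      EvalExpr (.U s) ρ noLoc c.cond (.bool true) →
      (∀ (i : ℕ) (c' : CtorCase), i ≠ j → cases[i]? = some c' →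
        EvalExpr (.U s) ρ noLoc c'.cond (.bool false)) →
      EvalCreates G s ρ c.creates A l s' →
      EvalCtorCases G s ρ cases A l s'

end

/-- The state `s[ℓ ↦ s(ℓ)[x ↦ v]]`, where `o = s(ℓ)`. -/
def setField (s : State) (l : Addr) (o : Obj) (x : Ident) (v : Value) : State :=
  s.insert l ⟨o.type, Function.update o.store x (some v)⟩

/-- `Ins (s ; ρ ; ref ; v) ⇓_ℓ s'` -/
inductive Ins : State → Env → Addr → Ref → Value → State → Prop
  | storage {s ρ l o x v} : s.lookup l = some o → (∃ v₀, o.store x = some v₀) →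
      Ins s ρ l (.var x) v (setField s l o x v)
  | field {s ρ l r l' o x v} : EvalRef (.U s) ρ l r (.base (.addr l')) .U →
      s.lookup l' = some o → (∃ v₀, o.store x = some v₀) →
      Ins s ρ l (.field r x) v (setField s l' o x v)

/-- Insertion of `v₁, …, vₙ` at `ref₁, …, refₙ`, one after the other. -/
inductive InsAll : State → Env → Addr → List Ref → List Value → State → Prop
  | nil {s ρ l} : InsAll s ρ l [] [] s
  | cons {s ρ l r rs v vs s' s''} : Ins s ρ l r v s' → InsAll s' ρ l rs vs s'' →
      InsAll s ρ l (r :: rs) (v :: vs) s''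

/-- `s ; ρ ; updates ⇓_ℓ s'`: first all right-hand sides, then all insertions. -/
def EvalUpdates (G : StateTyping) (s : State) (ρ : Env) (l : Addr) (us : List Update)
    (s' : State) : Prop :=
  ∃ vs sₙ, EvalSlots G s ρ l (us.map Update.rhs) vs sₙ ∧ InsAll sₙ ρ l (us.map Update.ref) vs s'

/-- Evaluation of an optional return expression. -/
inductive EvalRet : TState → Env → Addr → Option Expr → Option Value → Prop
  | none {st ρ l} : EvalRet st ρ l none none
  | some {st ρ l e v} : EvalExpr st ρ l e v → EvalRet st ρ l (some e) (some v)

/-- `s ; ρ ; tcases ⇓_ℓ (v, s')` -/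
def EvalTransCases (G : StateTyping) (s : State) (ρ : Env) (l : Addr) (cases : List TransCase)
    (v : Option Value) (s' : State) : Prop :=
  ∃ (j : ℕ) (c : TransCase), cases[j]? = some c ∧
    EvalExpr (.U s) ρ l c.cond (.bool true) ∧
    (∀ (i : ℕ) (c' : TransCase), i ≠ j → cases[i]? = some c' →
      EvalExpr (.U s) ρ l c'.cond (.bool false)) ∧
    EvalUpdates G s ρ l c.updates s' ∧
    EvalRet (.T s s') ρ l c.ret v

/-- `s ; ρ ; cnstr ⇓_A (ℓ, s')` -/
def EvalCtor (G : StateTyping) (s : State) (ρ : Env) (c : Constructor) (A : Ident) (l : Addr)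
    (s' : State) : Prop :=
  (∀ e ∈ c.pre, EvalExpr (.U s) ρ noLoc e (.bool true)) ∧ EvalCtorCases G s ρ c.cases A l s'

/-- `s ; ρ ; trans ⇓_ℓ (v, s')` -/
def EvalTrans (G : StateTyping) (s : State) (ρ : Env) (l : Addr) (t : Transition)
    (v : Option Value) (s' : State) : Prop :=
  (∀ e ∈ t.pre, EvalExpr (.U s) ρ l e (.bool true)) ∧ EvalTransCases G s ρ l t.cases v s'

/-! ### Value and environment typing -/

/-- `⊢ v : β` -/
inductive BaseTyped : BaseValue → BaseType → Prop
  | addr {l} : BaseTyped (.addr l) .address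
  | bool {b} : BaseTyped (.bool b) .bool
  | int {n ι} : ι.InRange n → BaseTyped (.int n) (.int ι)

/-- `⊢ v : μ` -/
inductive MapTyped : Value → MapType → Prop
  | base {b β} : BaseTyped b β → MapTyped (.base b) (.base β)
  | mapping {f β μ} : f.IsMap β →
      (∀ b u, BaseTyped b β → f.app b = some u → MapTyped u μ) →
      MapTyped f (.mapping β μ)

/-- `Σ ⊢ v :_s σ`. The judgment `Σ ⊢ v :_s α` for ABI types is `ValueTyped G s v α.toSlot`. -/
inductive ValueTyped (G : StateTyping) (s : State) : Value → SlotType → Prop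
  | map {v μ} : MapTyped v μ → ValueTyped G s v (.map μ)
  | contractAddr {l o A C} : s.lookup l = some o → G.storage A = some C → o.type = A →
      (∀ x, (∃ v, o.store x = some v) ↔ ∃ σ, C x = some σ) →
      (∀ x σ v, C x = some σ → o.store x = some v → ValueTyped G s v σ) →
      ValueTyped G s (.base (.addr l)) (.contractAddr A)
  | contract {l A} : ValueTyped G s (.base (.addr l)) (.contractAddr A) →
      ValueTyped G s (.base (.addr l)) (.contract A)

/-- `Σ ⊢ ℓ :_s A?` for an optional contract type. -/
def LocTyped (G : StateTyping) (s : State) (l : Addr) : Option Ident → Prop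
  | none => True
  | some A => ValueTyped G s (.base (.addr l)) (.contract A)

/-- `Σ ⊢ ρ :_s I` -/
structure EnvTyped (G : StateTyping) (s : State) (ρ : Env) (I : Iface) : Prop where
  dom : ∀ x, (∃ b, ρ (.var x) = some b) ↔ ∃ α, I.lookup x = some α
  vars : ∀ x α b, I.lookup x = some α → ρ (.var x) = some b → ValueTyped G s (.base b) α.toSlot
  caller : ∃ b, ρ .caller = some b ∧ BaseTyped b .address
  origin : ∃ b, ρ .origin = some b ∧ BaseTyped b .address
  callvalue : ∃ b, ρ .callvalue = some b ∧ BaseTyped b .uint256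

/-! ### Transitions between states -/

/-- `Σ ⊢_A s ⇝_ℓ^C s'` -/
def StepCnstr (G : StateTyping) (A : Ident) (l : Addr) (s s' : State) : Prop :=
  ∃ ρ c, G.cnstr A = some c ∧ EnvTyped G s ρ c.iface ∧ EvalCtor G s ρ c A l s'

/-- `Σ ⊢_A s ⇝_ℓ^B s'` -/
def StepTrans (G : StateTyping) (A : Ident) (l : Addr) (s s' : State) : Prop :=
  ∃ ρ ts t v, ValueTyped G s (.base (.addr l)) (.contract A) ∧ G.trans A = some ts ∧ t ∈ ts ∧
    EnvTyped G s ρ t.iface ∧ EvalTrans G s ρ l t v s'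

/-- `Σ ⊢ s ⇝ s'` -/
def Step (G : StateTyping) (s s' : State) : Prop :=
  (∃ A l, StepCnstr G A l s s') ∨ ∃ A l, StepTrans G A l s s'

/-- `Σ ⊢ s ⇝* s'` -/
def Steps (G : StateTyping) : State → State → Prop := Relation.ReflTransGen (Step G)

/-! ### Semantic entailment -/

/-- `Σ ; I ; Φ ⊨_{A?} e₁, …, eₙ` -/
def ValidExps (G : StateTyping) (I : Iface) (Φ : Expr) (A : Option Ident) (es : List Expr) : Prop :=
  ∀ s ρ l, EnvTyped G s ρ I → LocTyped G s l A → EvalExpr (.U s) ρ l Φ (.bool true) →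
    ∀ e ∈ es, EvalExpr (.U s) ρ l e (.bool true)

/-- `Σ ; I ; Φ ⊨_{A?} (se₁, …, seₙ ; pre')`, where `I'` is the interface of the constructor whose
preconditions are `pre'`. -/
def ValidIffs (G : StateTyping) (I : Iface) (Φ : Expr) (A : Option Ident) (ses : List SlotExpr)
    (I' : Iface) (pre' : List Expr) : Prop :=
  ∀ s ρ l bs sₙ, EnvTyped G s ρ I → LocTyped G s l A → EvalExpr (.U s) ρ l Φ (.bool true) →
    EvalSlots G s ρ l ses (bs.map .base) sₙ →
    ∀ e ∈ pre', EvalExpr (.U sₙ) (argEnv I' bs) noLoc e (.bool true)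

/-! ### Typing -/

def Expr.and (e₁ e₂ : Expr) : Expr := .bop .and e₁ e₂

def Expr.conj (es : List Expr) : Expr := es.foldr Expr.and (.bool true)

def Expr.disj (es : List Expr) : Expr := es.foldr (Expr.bop .or) (.bool false)

/-- The conjunction of `¬ (eᵢ ∧ eⱼ)` over `i < j`. -/
def Expr.disjoint : List Expr → Expr
  | [] => .bool true
  | e :: es => .and (.conj (es.map fun e' => .not (.and e e'))) (disjoint es)

/-- If the preconditions hold, exactly one of the case conditions holds:
`⋀ pre ⇒ (⋁ᵢ eᵢ) ∧ ⋀_{i<j} ¬ (eᵢ ∧ eⱼ)`. -/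
def Expr.caseCond (pre conds : List Expr) : Expr :=
  .bop .imp (.conj pre) (.and (.disj conds) (.disjoint conds))

/-- `Σ ⊢ α wf` -/
inductive ABIType.WF (G : StateTyping) : ABIType → Prop
  | int {ι} : ι ≠ .unbounded → WF G (.base (.int ι))
  | contractAddr {α} : (∀ A, α = .contractAddr A → ∃ C, G.storage A = some C) → WF G α

/-- `Σ ⊢ σ wf` -/
inductive SlotType.WF (G : StateTyping) : SlotType → Prop
  | contract {A C} : G.storage A = some C → WF G (.contract A)
  | abi {α : ABIType} : α.WF G → WF G α.toSlot
  | map {μ} : WF G (.map μ)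

/-- `Σ ⊢ I wf` -/
def Iface.WF (G : StateTyping) (I : Iface) : Prop := ∀ p ∈ I, p.2.WF G

/-- `S`: reachable from the current contract's storage without coercion; `N`: all others. -/
inductive RefKind
  | S | N

/-- Untimed or timed judgment. -/
inductive Tag
  | U | T

/-- `Σ ; I ⊢_{A?} env : α` -/
inductive EnvVarTyped : Option Ident → EnvVar → ABIType → Prop
  | caller {A} : EnvVarTyped A .caller (.base .address)
  | origin {A} : EnvVarTyped A .origin (.base .address)
  | callvalue {A} : EnvVarTyped A .callvalue (.base .uint256)
  | this {A} : EnvVarTyped (some A) .this (.contractAddr A)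

mutual

/-- `Σ ; I ⊢^k_{A?, t} ref : σ` -/
inductive RefTyped (G : StateTyping) (I : Iface) :
    RefKind → Option Ident → Tag → Ref → SlotType → Prop
  | calldata {A t x α} : I.lookup x = some α → RefTyped G I .N A t (.var x) α.toSlot
  | storage {A C x σ} : G.storage A = some C → C x = some σ → I.lookup x = none →
      RefTyped G I .S (some A) .U (.var x) σ
  | storagePre {A C x σ} : G.storage A = some C → C x = some σ → I.lookup x = none →
      RefTyped G I .S (some A) .T (.pre x) σ
  | storagePost {A C x σ} : G.storage A = some C → C x = some σ → I.lookup x = none →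
      RefTyped G I .S (some A) .T (.post x) σ
  | coerce {k A t r B} : RefTyped G I k A t r (.contractAddr B) →
      RefTyped G I .N A t (.coerce r B) (.contract B)
  | upcast {k A t r B} : RefTyped G I k A t r (.contractAddr B) →
      RefTyped G I .N A t r (.map (.base .address))
  | field {k A t r B C x σ} : RefTyped G I k A t r (.contract B) →
      G.storage B = some C → C x = some σ → RefTyped G I k A t (.field r x) σ
  | index {k A t r e β μ} : RefTyped G I k A t r (.map (.mapping β μ)) →
      ExprTyped G I (.bool true) A t e β → RefTyped G I .N A t (.index r e) (.map μ)
  | env {A ev α} : EnvVarTyped A ev α → RefTyped G I .N A .U (.env ev) α.toSlot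

/-- `Σ ; I ; Φ ⊢_{A?, t} e : β` -/
inductive ExprTyped (G : StateTyping) (I : Iface) :
    Expr → Option Ident → Tag → Expr → BaseType → Prop
  | int {Φ A t n ι} : ι.InRange n → ExprTyped G I Φ A t (.int n) (.int ι)
  | bool {Φ A t b} : ExprTyped G I Φ A t (.bool b) .bool
  | ref {Φ A t k r β} : RefTyped G I k A t r (.map (.base β)) →
      ExprTyped G I Φ A t (.ref r (.base β)) β
  | addr {Φ A k r B} : RefTyped G I k A .U r (.contract B) →
      ExprTyped G I Φ A .U (.addr r B) .address
  | range {Φ A t ι₁ ι₂ e} : ExprTyped G I Φ A t e (.int ι₂) →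
      ExprTyped G I Φ A t (.inrange ι₁ e) .bool
  | iop {Φ A t op e₁ e₂ ι₁ ι₂ ι} : ExprTyped G I Φ A t e₁ (.int ι₁) →
      ExprTyped G I Φ A t e₂ (.int ι₂) → (t = .T → ι = .unbounded) →
      ValidExps G I Φ A [.inrange ι (.iop op e₁ e₂)] →
      ExprTyped G I Φ A t (.iop op e₁ e₂) (.int ι)
  | numConv {Φ A t e ι₁ ι₂} : ExprTyped G I Φ A t e (.int ι₁) →
      (ι₂ ≠ .unbounded → ValidExps G I Φ A [.inrange ι₂ e]) →
      ExprTyped G I Φ A t e (.int ι₂)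
  | bop {Φ A t op e₁ e₂} : ExprTyped G I Φ A t e₁ .bool → ExprTyped G I Φ A t e₂ .bool →
      ExprTyped G I Φ A t (.bop op e₁ e₂) .bool
  | not {Φ A t e} : ExprTyped G I Φ A t e .bool → ExprTyped G I Φ A t (.not e) .bool
  | cmp {Φ A t op e₁ e₂ ι} : ExprTyped G I Φ A t e₁ (.int ι) → ExprTyped G I Φ A t e₂ (.int ι) →
      ExprTyped G I Φ A t (.cmp op e₁ e₂) .bool
  | ite {Φ A t e₁ e₂ e₃ β} : ExprTyped G I Φ A t e₁ .bool → ExprTyped G I Φ A t e₂ β →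
      ExprTyped G I Φ A t e₃ β → ExprTyped G I Φ A t (.ite e₁ e₂ e₃) β
  | eq {Φ A t e₁ e₂ β} : ExprTyped G I Φ A t e₁ β → ExprTyped G I Φ A t e₂ β →
      ExprTyped G I Φ A t (.eq e₁ e₂) .bool

end

/-- `Σ ; I ; Φ ⊢_{A?} m : μ` -/
inductive MapExprTyped (G : StateTyping) (I : Iface) (Φ : Expr) (A : Option Ident) :
    MapExpr → MapType → Prop
  | exp {e β} : ExprTyped G I Φ A .U e β → MapExprTyped G I Φ A (.exp e) (.base β)
  | map {kvs β μ} : (∀ p ∈ kvs, ExprTyped G I Φ A .U p.1 β) →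
      (∀ p ∈ kvs, MapExprTyped G I Φ A p.2 μ) →
      MapExprTyped G I Φ A (.map kvs β μ) (.mapping β μ)
  | upd {k r kvs β μ} : RefTyped G I k A .U r (.map (.mapping β μ)) →
      (∀ p ∈ kvs, ExprTyped G I Φ A .U p.1 β) →
      (∀ p ∈ kvs, MapExprTyped G I Φ A p.2 μ) →
      MapExprTyped G I Φ A (.upd r kvs β μ) (.mapping β μ)

/-- `Σ ; I ; Φ ⊢_{A?} se : σ` -/
inductive SlotTyped (G : StateTyping) (I : Iface) (Φ : Expr) (A : Option Ident) :
    SlotExpr → SlotType → Prop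
  | map {m μ} : MapExprTyped G I Φ A m μ → SlotTyped G I Φ A (.map m) (.map μ)
  | ref {k r B} : RefTyped G I k A .U r (.contract B) → SlotTyped G I Φ A (.ref r B) (.contract B)
  | addr {se B} : SlotTyped G I Φ A se (.contract B) →
      SlotTyped G I Φ A (.addr se) (.contractAddr B)
  | new {B ctor ses} : G.cnstr B = some ctor → ctor.payable = false →
      ctor.iface.length = ses.length →
      (∀ p ∈ ses.zip ctor.iface, SlotTyped G I Φ A p.1 p.2.2.toSlot) →
      ValidIffs G I Φ A ses ctor.iface ctor.pre →
      SlotTyped G I Φ A (.new B ses) (.contract B)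
  | newPayable {B ctor val ses} : G.cnstr B = some ctor → ctor.payable = true →
      ctor.iface.length = ses.length →
      (∀ p ∈ ses.zip ctor.iface, SlotTyped G I Φ A p.1 p.2.2.toSlot) →
      SlotTyped G I Φ A val (.map (.base .uint256)) →
      ValidIffs G I Φ A ses ctor.iface ctor.pre →
      SlotTyped G I Φ A (.newPayable B val ses) (.contract B)

/-- `Σ ; I ; Φ ⊢_A creates : C` -/
def CreatesTyped (G : StateTyping) (I : Iface) (Φ : Expr) (cs : List Create) (C : Storage) : Prop :=
  (∀ c ∈ cs, c.type.WF G) ∧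
  C = assign (cs.map Create.name) (cs.map Create.type) ∧
  C balanceName = some (.map (.base .uint256)) ∧
  ∀ c ∈ cs, SlotTyped G I Φ none c.rhs c.type

/-- `ref ≺_specific ref'` -/
inductive MoreSpecific : Ref → Ref → Prop
  | field {r x} : MoreSpecific (.field r x) r
  | step {r₁ r₂ x} : MoreSpecific r₁ r₂ → MoreSpecific (.field r₁ x) r₂

/-- `Σ ; I ; Φ ⊢_A ref_σ := se` -/
def UpdateTyped (G : StateTyping) (I : Iface) (Φ : Expr) (A : Ident) (u : Update) : Prop :=
  RefTyped G I .S (some A) .U u.ref u.type ∧ SlotTyped G I Φ (some A) u.rhs u.type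

/-- `Σ ; I ; Φ ⊢_A updates`. An update must not be preceded by one of a more specific reference. -/
def UpdatesTyped (G : StateTyping) (I : Iface) (Φ : Expr) (A : Ident) (us : List Update) : Prop :=
  (∀ u ∈ us, UpdateTyped G I Φ A u) ∧
  ∀ (i j : ℕ) (uᵢ uⱼ : Update), j ≤ i → us[i]? = some uᵢ → us[j]? = some uⱼ →
    ¬ MoreSpecific uⱼ.ref uᵢ.ref

/-- `Σ ⊢_A cnstr : C`. There is at least one case. -/
structure CtorTyped (G : StateTyping) (A : Ident) (c : Constructor) (C : Storage) : Prop where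
  nonempty : c.cases ≠ []
  iface : c.iface.WF G
  pre : ∀ e ∈ c.pre, ExprTyped G c.iface (.bool true) none .U e .bool
  conds : ∀ k ∈ c.cases, ExprTyped G c.iface (.bool true) none .U k.cond .bool
  creates : ∀ k ∈ c.cases, CreatesTyped G c.iface (.and k.cond (.conj c.pre)) k.creates C
  disjoint : ∀ x, C x = none ∨ c.iface.lookup x = none
  post : ∀ e ∈ c.post, ExprTyped (G.addStorage A C) c.iface (.bool true) (some A) .U e .bool
  exactlyOne : ValidExps G c.iface (.bool true) none [.caseCond c.pre (c.cases.map CtorCase.cond)]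

/-- The optional return expression of a case has the optional return type of the transition. -/
inductive RetTyped (G : StateTyping) (I : Iface) (A : Ident) :
    Option Expr → Option ABIType → Prop
  | none : RetTyped G I A none none
  | some {e β} : ExprTyped G I (.bool true) (some A) .T e β → RetTyped G I A (some e) (some (.base β))

/-- `Σ ⊢_A trans` -/
structure TransTyped (G : StateTyping) (A : Ident) (t : Transition) : Prop where
  iface : t.iface.WF G
  pre : ∀ e ∈ t.pre, ExprTyped G t.iface (.bool true) (some A) .U e .bool
  conds : ∀ k ∈ t.cases, ExprTyped G t.iface (.bool true) (some A) .U k.cond .bool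
  updates : ∀ k ∈ t.cases, UpdatesTyped G t.iface (.and k.cond (.conj t.pre)) A k.updates
  ret : ∀ k ∈ t.cases, RetTyped G t.iface A k.ret t.retType
  post : ∀ e ∈ t.post, ExprTyped G t.iface (.bool true) (some A) .T e .bool
  exactlyOne :
    ValidExps G t.iface (.bool true) (some A) [.caseCond t.pre (t.cases.map TransCase.cond)]

/-- Well-typed state typings, defined inductively. The functions `w` and `w'` choose, for each
contract `A`, the smaller well-typed state typing in which the constructor, respectively the
transitions, of `A` are typed. The contracts with a storage typing are those with a constructor. -/
inductive WellTyped : StateTyping → Prop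
  | mk {G : StateTyping} (w w' : Ident → StateTyping)
      (dom : ∀ A, (∃ C, G.storage A = some C) ↔ ∃ c, G.cnstr A = some c)
      (cnstr_sub : ∀ A c, G.cnstr A = some c → (w A).SSub G)
      (cnstr_wt : ∀ A c, G.cnstr A = some c → WellTyped (w A))
      (cnstr_typed : ∀ A c C, G.cnstr A = some c → G.storage A = some C → CtorTyped (w A) A c C)
      (trans_sub : ∀ A ts, G.trans A = some ts → (w' A).SSub G)
      (trans_wt : ∀ A ts, G.trans A = some ts → WellTyped (w' A))
      (trans_typed : ∀ A ts, G.trans A = some ts → ∀ t ∈ ts, TransTyped (w' A) A t) :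
      WellTyped G

end Act

namespace Act

/-! ### Well-typed state typings -/

theorem StateTyping.Sub.trans {G₁ G₂ G₃ : StateTyping} (h : G₁.Sub G₂) (h' : G₂.Sub G₃) :
    G₁.Sub G₃ :=
  ⟨fun _ _ e => h'.1 _ _ (h.1 _ _ e), fun _ _ e => h'.2.1 _ _ (h.2.1 _ _ e),
    fun _ _ e => h'.2.2 _ _ (h.2.2 _ _ e)⟩

theorem StateTyping.Sub.refl (G : StateTyping) : G.Sub G :=
  ⟨fun _ _ e => e, fun _ _ e => e, fun _ _ e => e⟩

/-- The contract that a slot type refers to, if any, is declared. -/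
def SlotType.Known (G : StateTyping) : SlotType → Prop
  | .map _ => True
  | .contractAddr A => ∃ C, G.storage A = some C
  | .contract A => ∃ C, G.storage A = some C

theorem ABIType.WF.known {G : StateTyping} {α : ABIType} (h : α.WF G) : α.toSlot.Known G := by
  cases h with
  | int => trivial
  | contractAddr h =>
    cases α with
    | base => trivial
    | contractAddr A => exact h A rfl

theorem SlotType.WF.known {G : StateTyping} {σ : SlotType} (h : σ.WF G) : σ.Known G := by
  cases h with
  | contract h => exact ⟨_, h⟩
  | abi h => exact h.known
  | map => trivial

theorem mem_zip_of_assign {V : Type} {xs : List Ident} {vs : List V} {x : Ident} {v : V}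
    (h : assign xs vs x = some v) : (x, v) ∈ xs.zip vs := by
  unfold assign at h
  induction xs generalizing vs with
  | nil => simp at h
  | cons y ys ih =>
    cases vs with
    | nil => simp at h
    | cons w ws =>
      rw [List.zip_cons_cons, List.lookup_cons] at h
      by_cases e : x = y
      · subst e
        simp at h
        simp [h]
      · have e' : (x == y) = false := by simpa using e
        rw [e'] at h
        exact List.mem_cons_of_mem _ (ih h)

theorem CtorTyped.known {G : StateTyping} {A : Ident} {c : Constructor} {C : Storage}
    (h : CtorTyped G A c C) {x : Ident} {σ : SlotType} (hx : C x = some σ) : σ.Known G := by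
  obtain ⟨k, hk⟩ := List.exists_mem_of_ne_nil _ h.nonempty
  obtain ⟨hwf, hC, -, -⟩ := h.creates k hk
  rw [hC] at hx
  have := (List.of_mem_zip (mem_zip_of_assign hx)).2
  obtain ⟨d, hd, rfl⟩ := List.mem_map.1 this
  exact (hwf d hd).known

theorem WellTyped.ctor {G : StateTyping} (hG : WellTyped G) {A : Ident} {c : Constructor}
    (hc : G.cnstr A = some c) :
    ∃ G' C, WellTyped G' ∧ G'.Sub G ∧ G.storage A = some C ∧ CtorTyped G' A c C := by
  cases hG with
  | mk w w' dom cs cw ct =>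
    obtain ⟨C, hC⟩ := (dom A).2 ⟨c, hc⟩
    exact ⟨w A, C, cw A c hc, (cs A c hc).1, hC, ct A c C hc hC⟩

/-- Induction on the types that are declared in a well-typed state typing: the types of the
fields of a contract come before that contract. -/
theorem WellTyped.known_induction {G : StateTyping} (hG : WellTyped G) {P : SlotType → Prop}
    (map : ∀ μ, P (.map μ))
    (contractAddr : ∀ A C, G.storage A = some C → (∀ x σ, C x = some σ → P σ) →
      P (.contractAddr A))
    (contract : ∀ A, P (.contractAddr A) → P (.contract A)) {σ : SlotType} (hσ : σ.Known G) :
    P σ := by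
  suffices H : ∀ H : StateTyping, WellTyped H → H.Sub G → ∀ σ : SlotType, σ.Known H → P σ from
    H G hG (.refl G) σ hσ
  intro H hH
  induction hH with
  | @mk H w w' dom cs cw ct ts tw tt ih _ =>
    intro hs σ hσ
    have key : ∀ A, (∃ C, H.storage A = some C) → P (.contractAddr A) := by
      rintro A ⟨C, hC⟩
      obtain ⟨c, hc⟩ := (dom A).1 ⟨C, hC⟩
      exact contractAddr A C (hs.1 _ _ hC) fun x τ hx =>
        ih A c hc ((cs A c hc).1.trans hs) τ ((ct A c C hc hC).known hx)
    cases σ with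
    | map μ => exact map μ
    | contractAddr A => exact key A hσ
    | contract A => exact contract A (key A hσ)

theorem WellTyped.known_field {G : StateTyping} (hG : WellTyped G) {A : Ident} {C : Storage}
    (hC : G.storage A = some C) {x : Ident} {σ : SlotType} (hx : C x = some σ) : σ.Known G := by
  cases hG with
  | mk w w' dom cs cw ct =>
    obtain ⟨c, hc⟩ := (dom A).1 ⟨C, hC⟩
    have hk := (ct A c C hc hC).known hx
    cases σ with
    | map => trivial
    | contractAddr B => exact hk.imp fun _ => (cs A c hc).1.1 _ _
    | contract B => exact hk.imp fun _ => (cs A c hc).1.1 _ _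

/-! ### Inversion and monotonicity of value typing -/

/-- The location `l` holds an instance of `A`, with the fields of `C` and values of their types. -/
def Instance (G : StateTyping) (s : State) (l : Addr) (A : Ident) (C : Storage) : Prop :=
  ∃ o, s.lookup l = some o ∧ o.type = A ∧
    (∀ x, (∃ v, o.store x = some v) ↔ ∃ σ, C x = some σ) ∧
    ∀ x σ v, C x = some σ → o.store x = some v → ValueTyped G s v σ

theorem Instance.contractAddr {G : StateTyping} {s : State} {l : Addr} {A : Ident} {C : Storage}
    (h : Instance G s l A C) (hC : G.storage A = some C) :
    ValueTyped G s (.base (.addr l)) (.contractAddr A) := by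
  obtain ⟨o, ho, ht, hd, hv⟩ := h
  exact .contractAddr ho hC ht hd hv

theorem valueTyped_contractAddr_iff {G : StateTyping} {s : State} {v : Value} {A : Ident} :
    ValueTyped G s v (.contractAddr A) ↔
      ∃ l C, v = .base (.addr l) ∧ G.storage A = some C ∧ Instance G s l A C := by
  constructor
  · intro h
    cases h with
    | contractAddr ho hC ht hd hv => exact ⟨_, _, rfl, hC, _, ho, ht, hd, hv⟩
  · rintro ⟨l, C, rfl, hC, h⟩
    exact h.contractAddr hC

theorem valueTyped_contract_iff {G : StateTyping} {s : State} {v : Value} {A : Ident} :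
    ValueTyped G s v (.contract A) ↔ ValueTyped G s v (.contractAddr A) := by
  constructor
  · intro h
    cases h with
    | contract h => exact h
  · intro h
    obtain ⟨l, C, rfl, -⟩ := valueTyped_contractAddr_iff.1 h
    exact .contract h

theorem valueTyped_map_iff {G : StateTyping} {s : State} {v : Value} {μ : MapType} :
    ValueTyped G s v (.map μ) ↔ MapTyped v μ :=
  ⟨fun h => by cases h; assumption, .map⟩

theorem mapTyped_base_iff {v : Value} {β : BaseType} :
    MapTyped v (.base β) ↔ ∃ b, v = .base b ∧ BaseTyped b β := by
  constructor
  · intro h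
    cases h with
    | base h => exact ⟨_, rfl, h⟩
  · rintro ⟨b, rfl, h⟩
    exact .base h

theorem valueTyped_base_iff {G : StateTyping} {s : State} {v : Value} {β : BaseType} :
    ValueTyped G s v (.map (.base β)) ↔ ∃ b, v = .base b ∧ BaseTyped b β :=
  valueTyped_map_iff.trans mapTyped_base_iff

theorem ValueTyped.mono {G G' : StateTyping} (h : G'.Sub G) {s : State} {v : Value} {σ : SlotType}
    (hv : ValueTyped G' s v σ) : ValueTyped G s v σ := by
  induction hv with
  | map h => exact .map h
  | contractAddr ho hC ht hd _ ih => exact .contractAddr ho (h.1 _ _ hC) ht hd ih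
  | contract _ ih => exact .contract ih

theorem ValueTyped.restrict {G G' : StateTyping} (hG' : WellTyped G') (h : G'.Sub G) {s : State}
    {v : Value} {σ : SlotType} (hv : ValueTyped G s v σ) (hσ : σ.Known G') :
    ValueTyped G' s v σ := by
  induction hv with
  | map h => exact .map h
  | @contractAddr l o A C ho hC ht hd _ ih =>
    obtain ⟨C', hC'⟩ := hσ
    obtain rfl : C' = C := Option.some.inj ((h.1 _ _ hC').symm.trans hC)
    exact .contractAddr ho hC' ht hd fun x σ v hx hv => ih x σ v hx hv (hG'.known_field hC' hx)
  | contract _ ih => exact .contract (ih hσ)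

/-- `s'` agrees with `s` on the domain of `s`. -/
def Extends (s s' : State) : Prop := ∀ l o, s.lookup l = some o → s'.lookup l = some o

theorem Extends.refl (s : State) : Extends s s := fun _ _ h => h

theorem Extends.trans {s₁ s₂ s₃ : State} (h : Extends s₁ s₂) (h' : Extends s₂ s₃) :
    Extends s₁ s₃ := fun l o e => h' l o (h l o e)

theorem Extends.keys_subset {s s' : State} (h : Extends s s') : s.keys ⊆ s'.keys := by
  intro l hl
  rw [Finmap.mem_keys, Finmap.mem_iff] at hl ⊢
  exact hl.imp (h l)

theorem lookup_fresh (s : State) : s.lookup (fresh s) = none := by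
  rw [Finmap.lookup_eq_none, ← Finmap.mem_keys]
  intro h
  have : fresh s ≤ s.keys.sup id := Finset.le_sup (f := id) h
  exact absurd this (Nat.not_succ_le_self _)

theorem extends_insert_fresh (s : State) (o : Obj) : Extends s (s.insert (fresh s) o) := by
  intro l o' h
  rw [Finmap.lookup_insert_of_ne, h]
  rintro rfl
  rw [lookup_fresh] at h
  cases h

theorem ValueTyped.extend {G : StateTyping} {s s' : State} (h : Extends s s') {v : Value}
    {σ : SlotType} (hv : ValueTyped G s v σ) : ValueTyped G s' v σ := by
  induction hv with
  | map h => exact .map h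
  | contractAddr ho hC ht hd _ ih => exact .contractAddr (h _ _ ho) hC ht hd ih
  | contract _ ih => exact .contract ih

theorem EnvTyped.imp {G G' : StateTyping} {s s' : State} {ρ : Env} {I : Iface}
    (h : EnvTyped G s ρ I)
    (hv : ∀ x α v, I.lookup x = some α → ValueTyped G s v α.toSlot → ValueTyped G' s' v α.toSlot) :
    EnvTyped G' s' ρ I where
  dom := h.dom
  vars x α b hx hb := hv x α _ hx (h.vars x α b hx hb)
  caller := h.caller
  origin := h.origin
  callvalue := h.callvalue

theorem zip_fst_snd (I : Iface) : (I.map Prod.fst).zip (I.map Prod.snd) = I := by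
  induction I with
  | nil => rfl
  | cons p I ih => simp [ih]

theorem mem_of_lookup {I : Iface} {x : Ident} {α : ABIType} (h : I.lookup x = some α) :
    (x, α) ∈ I := by
  rw [← zip_fst_snd I] at h ⊢
  exact mem_zip_of_assign h

theorem EnvTyped.restrict {G G' : StateTyping} (hG' : WellTyped G') (hs : G'.Sub G) {s : State}
    {ρ : Env} {I : Iface} (hI : I.WF G') (h : EnvTyped G s ρ I) : EnvTyped G' s ρ I :=
  h.imp fun _ _ _ hx hv => hv.restrict hG' hs (hI _ (mem_of_lookup hx)).known

theorem LocTyped.imp {G G' : StateTyping} {s s' : State} {l : Addr} {A : Option Ident}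
    (h : LocTyped G s l A)
    (hv : ∀ B v, ValueTyped G s v (.contract B) → ValueTyped G' s' v (.contract B)) :
    LocTyped G' s' l A := by
  cases A with
  | none => trivial
  | some B => exact hv B _ h

/-! ### Evaluation in extended states and environments -/

theorem Reads.extend {s s' : State} (h : Extends s s') {l : Addr} {x : Ident} {v : Value}
    (hr : Reads s l x v) : Reads s' l x v := by
  obtain ⟨o, ho, hv⟩ := hr
  exact ⟨o, h _ _ ho, hv⟩

/-- `ρ'` agrees with `ρ` on the variables, and extends it on the keywords. -/
def EnvExtends (ρ ρ' : Env) : Prop :=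
  (∀ x, ρ' (.var x) = ρ (.var x)) ∧ ∀ k b, ρ k = some b → ρ' k = some b

theorem EnvExtends.refl (ρ : Env) : EnvExtends ρ ρ := ⟨fun _ => rfl, fun _ _ h => h⟩

mutual

theorem EvalRef.extend {st : TState} {s' : State} {ρ ρ' : Env} {l : Addr} {r : Ref} {v : Value}
    {t : Timing} (hs : ∀ s, st = .U s → Extends s s') (hst : ∃ s, st = .U s)
    (hρ : EnvExtends ρ ρ') : EvalRef st ρ l r v t → EvalRef (.U s') ρ' l r v t
  | .env (.caller h) => .env (.caller (hρ.2 _ _ h))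
  | .env (.origin h) => .env (.origin (hρ.2 _ _ h))
  | .env (.callvalue h) => .env (.callvalue (hρ.2 _ _ h))
  | .env .this => .env .this
  | .storage h hx => .storage (h.extend (hs _ rfl)) (by rw [hρ.1, hx])
  | .calldata h => .calldata (hρ.2 _ _ h)
  | .coerce h => .coerce (h.extend hs hst hρ)
  | .field h hr => .field (h.extend hs hst hρ) (hr.extend (hs _ rfl))
  | .index he hr ha => .index (he.extend hs hst hρ) (hr.extend hs hst hρ) ha
  | .storagePre _ _ => by simp at hst
  | .storagePost _ _ => by simp at hst
  | .calldataTimed _ => by simp at hst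
  | .fieldPre _ _ => by simp at hst
  | .fieldPost _ _ => by simp at hst

theorem EvalExpr.extend {st : TState} {s' : State} {ρ ρ' : Env} {l : Addr} {e : Expr} {v : Value}
    (hs : ∀ s, st = .U s → Extends s s') (hst : ∃ s, st = .U s)
    (hρ : EnvExtends ρ ρ') : EvalExpr st ρ l e v → EvalExpr (.U s') ρ' l e v
  | .int => .int
  | .bool => .bool
  | .ref h => .ref (h.extend hs hst hρ)
  | .addr h => .addr (h.extend hs hst hρ)
  | .rangeTrue h hr => .rangeTrue (h.extend hs hst hρ) hr
  | .rangeFalse h hr => .rangeFalse (h.extend hs hst hρ) hr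
  | .div h h' hn => .div (h.extend hs hst hρ) (h'.extend hs hst hρ) hn
  | .divZero h h' => .divZero (h.extend hs hst hρ) (h'.extend hs hst hρ)
  | .mod h h' hn => .mod (h.extend hs hst hρ) (h'.extend hs hst hρ) hn
  | .modZero h h' => .modZero (h.extend hs hst hρ) (h'.extend hs hst hρ)
  | .iop h h' hk => .iop (h.extend hs hst hρ) (h'.extend hs hst hρ) hk
  | .bop h h' => .bop (h.extend hs hst hρ) (h'.extend hs hst hρ)
  | .not h => .not (h.extend hs hst hρ)
  | .cmp h h' => .cmp (h.extend hs hst hρ) (h'.extend hs hst hρ)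
  | .iteTrue h h' => .iteTrue (h.extend hs hst hρ) (h'.extend hs hst hρ)
  | .iteFalse h h' => .iteFalse (h.extend hs hst hρ) (h'.extend hs hst hρ)
  | .eqTrue h h' e => .eqTrue (h.extend hs hst hρ) (h'.extend hs hst hρ) e
  | .eqFalse h h' e => .eqFalse (h.extend hs hst hρ) (h'.extend hs hst hρ) e

end

theorem EvalExpr.extend_untimed {s s' : State} (hs : Extends s s') {ρ ρ' : Env}
    (hρ : EnvExtends ρ ρ') {l : Addr} {e : Expr} {v : Value} (h : EvalExpr (.U s) ρ l e v) :
    EvalExpr (.U s') ρ' l e v :=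
  h.extend (by rintro _ ⟨⟩; exact hs) ⟨s, rfl⟩ hρ

theorem EvalExpr.and_true {st : TState} {ρ : Env} {l : Addr} {e₁ e₂ : Expr}
    (h₁ : EvalExpr st ρ l e₁ (.bool true)) (h₂ : EvalExpr st ρ l e₂ (.bool true)) :
    EvalExpr st ρ l (.and e₁ e₂) (.bool true) :=
  .bop (op := .and) h₁ h₂

theorem EvalExpr.conj_true {st : TState} {ρ : Env} {l : Addr} {es : List Expr}
    (h : ∀ e ∈ es, EvalExpr st ρ l e (.bool true)) : EvalExpr st ρ l (.conj es) (.bool true) := by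
  induction es with
  | nil => exact .bool
  | cons e es ih =>
    exact .and_true (h e (by simp)) (ih fun e' he' => h e' (by simp [he']))

/-! ### Determinism of expression evaluation -/

theorem EvalEnv.det {ρ : Env} {l : Addr} {ev : EnvVar} {b b' : BaseValue} (h : EvalEnv ρ l ev b)
    (h' : EvalEnv ρ l ev b') : b = b' := by
  cases h <;> cases h' <;> simp_all

theorem Reads.det {s : State} {l : Addr} {x : Ident} {v v' : Value} (h : Reads s l x v)
    (h' : Reads s l x v') : v = v' := by
  obtain ⟨o, ho, hv⟩ := h
  obtain ⟨o', ho', hv'⟩ := h'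
  simp_all

mutual

theorem EvalRef.det {st : TState} {ρ : Env} {l : Addr} {r : Ref} {v : Value} {t : Timing} :
    EvalRef st ρ l r v t → ∀ {v' : Value} {t' : Timing}, EvalRef st ρ l r v' t' → v = v' ∧ t = t'
  | .env h, _, _, h' => by cases h' with | env h' => exact ⟨by rw [h.det h'], rfl⟩
  | .storage h hx, _, _, h' => by
    cases h' with
    | storage h' => exact ⟨h.det h', rfl⟩
    | calldata h' => simp_all
  | .storagePre h hx, _, _, h' => by cases h' with | storagePre h' => exact ⟨h.det h', rfl⟩
  | .storagePost h hx, _, _, h' => by cases h' with | storagePost h' => exact ⟨h.det h', rfl⟩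
  | .calldata h, _, _, h' => by
    cases h' with
    | storage _ h' => simp_all
    | calldata h' => simp_all
  | .calldataTimed h, _, _, h' => by cases h' with | calldataTimed h' => simp_all
  | .coerce h, _, _, h' => by cases h' with | coerce h' => exact h.det h'
  | .field h hr, _, _, h' => by
    cases h' with
    | field h' hr' =>
      obtain ⟨⟨⟩, -⟩ := h.det h'
      exact ⟨hr.det hr', rfl⟩
  | .fieldPre h hr, _, _, h' => by
    cases h' with
    | fieldPre h' hr' =>
      obtain ⟨⟨⟩, -⟩ := h.det h'
      exact ⟨hr.det hr', rfl⟩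
    | fieldPost h' hr' => cases (h.det h').2
  | .fieldPost h hr, _, _, h' => by
    cases h' with
    | fieldPre h' hr' => cases (h.det h').2
    | fieldPost h' hr' =>
      obtain ⟨⟨⟩, -⟩ := h.det h'
      exact ⟨hr.det hr', rfl⟩
  | .index he hr ha, _, _, h' => by
    cases h' with
    | index he' hr' ha' =>
      cases he.det he'
      obtain ⟨rfl, rfl⟩ := hr.det hr'
      exact ⟨Option.some.inj (ha.symm.trans ha'), rfl⟩

theorem EvalExpr.det {st : TState} {ρ : Env} {l : Addr} {e : Expr} {v : Value} :
    EvalExpr st ρ l e v → ∀ {v' : Value}, EvalExpr st ρ l e v' → v = v'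
  | .int, _, h' => by cases h'; rfl
  | .bool, _, h' => by cases h'; rfl
  | .ref h, _, h' => by cases h' with | ref h' => exact (h.det h').1
  | .addr h, _, h' => by cases h' with | addr h' => exact (h.det h').1
  | .rangeTrue h hr, _, h' => by
    cases h' with
    | rangeTrue => rfl
    | rangeFalse h' hr' => cases h.det h'; exact absurd hr hr'
  | .rangeFalse h hr, _, h' => by
    cases h' with
    | rangeFalse => rfl
    | rangeTrue h' hr' => cases h.det h'; exact absurd hr' hr
  | .div h k hn, _, h' => by
    cases h' with
    | div h' k' => cases h.det h'; cases k.det k'; rfl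
    | divZero h' k' => cases k.det k'; exact absurd rfl hn
    | iop _ _ hk => cases hk
  | .divZero h k, _, h' => by
    cases h' with
    | div h' k' hn => cases k.det k'; exact absurd rfl hn
    | divZero => rfl
    | iop _ _ hk => cases hk
  | .mod h k hn, _, h' => by
    cases h' with
    | mod h' k' => cases h.det h'; cases k.det k'; rfl
    | modZero h' k' => cases k.det k'; exact absurd rfl hn
    | iop _ _ hk => cases hk
  | .modZero h k, _, h' => by
    cases h' with
    | mod h' k' hn => cases k.det k'; exact absurd rfl hn
    | modZero => rfl
    | iop _ _ hk => cases hk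
  | .iop h k hk, _, h' => by
    cases h' with
    | iop h' k' hk' => cases h.det h'; cases k.det k'; simp_all
    | div => cases hk
    | divZero => cases hk
    | mod => cases hk
    | modZero => cases hk
  | .bop h k, _, h' => by cases h' with | bop h' k' => cases h.det h'; cases k.det k'; rfl
  | .not h, _, h' => by cases h' with | not h' => cases h.det h'; rfl
  | .cmp h k, _, h' => by cases h' with | cmp h' k' => cases h.det h'; cases k.det k'; rfl
  | .iteTrue h k, _, h' => by
    cases h' with
    | iteTrue h' k' => exact k.det k'
    | iteFalse h' k' => cases h.det h'
  | .iteFalse h k, _, h' => by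
    cases h' with
    | iteTrue h' k' => cases h.det h'
    | iteFalse h' k' => exact k.det k'
  | .eqTrue h k e, _, h' => by
    cases h' with
    | eqTrue => rfl
    | eqFalse h' k' e' => cases h.det h'; cases k.det k'; exact absurd e e'
  | .eqFalse h k e, _, h' => by
    cases h' with
    | eqTrue h' k' e' => cases h.det h'; cases k.det k'; exact absurd e' e
    | eqFalse => rfl

end
/-! ### Type safety of references and expressions -/

theorem EvalEnv.safe {G : StateTyping} {I : Iface} {A : Option Ident} {s : State} {ρ : Env}
    {l : Addr} {ev : EnvVar} {α : ABIType} {b : BaseValue} (hρ : EnvTyped G s ρ I)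
    (hl : LocTyped G s l A) (ht : EnvVarTyped A ev α) (h : EvalEnv ρ l ev b) :
    ValueTyped G s (.base b) α.toSlot := by
  cases ht with
  | caller =>
    cases h with
    | caller h =>
      obtain ⟨b', hb, ht⟩ := hρ.caller
      cases hb.symm.trans h
      exact .map (.base ht)
  | origin =>
    cases h with
    | origin h =>
      obtain ⟨b', hb, ht⟩ := hρ.origin
      cases hb.symm.trans h
      exact .map (.base ht)
  | callvalue =>
    cases h with
    | callvalue h =>
      obtain ⟨b', hb, ht⟩ := hρ.callvalue
      cases hb.symm.trans h
      exact .map (.base ht)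
  | this =>
    cases h with
    | this => exact valueTyped_contract_iff.1 hl

theorem ValidExps.inRange {G : StateTyping} {I : Iface} {Φ : Expr} {A : Option Ident}
    {s : State} {ρ : Env} {l : Addr} {ι : IntType} {e : Expr} {v : Value}
    (hv : ValidExps G I Φ A [.inrange ι e]) (hρ : EnvTyped G s ρ I) (hl : LocTyped G s l A)
    (hΦ : EvalExpr (.U s) ρ l Φ (.bool true)) (h : EvalExpr (.U s) ρ l e v) :
    ∃ b, v = .base b ∧ BaseTyped b (.int ι) := by
  cases hv s ρ l hρ hl hΦ _ (List.mem_singleton.2 rfl) with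
  | rangeTrue h' hr =>
    cases h'.det h
    exact ⟨_, rfl, .int hr⟩

mutual

theorem RefTyped.safe {G : StateTyping} {I : Iface} {k : RefKind} {A : Option Ident} {tag : Tag}
    {r : Ref} {σ : SlotType} {s : State} {ρ : Env} {l : Addr} (hρ : EnvTyped G s ρ I)
    (hl : LocTyped G s l A) (htag : tag = .U) :
    RefTyped G I k A tag r σ → ∀ {v : Value} {t : Timing}, EvalRef (.U s) ρ l r v t →
      ValueTyped G s v σ
  | .calldata (x := x) hx, _, _, h => by
    cases h with
    | storage _ hn =>
      obtain ⟨b, hb⟩ := (hρ.dom x).2 ⟨_, hx⟩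
      cases hb.symm.trans hn
    | calldata h => exact hρ.vars _ _ _ hx h
  | .storage (x := x) hC hσ hx, _, _, h => by
    cases h with
    | storage hr =>
      obtain ⟨_, C', ⟨⟩, hC', o, ho, -, -, hf⟩ :=
        valueTyped_contractAddr_iff.1 (valueTyped_contract_iff.1 hl)
      cases hC.symm.trans hC'
      obtain ⟨o', ho', hv⟩ := hr
      cases ho.symm.trans ho'
      exact hf _ _ _ hσ hv
    | calldata h =>
      obtain ⟨α, hα⟩ := (hρ.dom x).1 ⟨_, h⟩
      cases hα.symm.trans hx
  | .storagePre _ _ _, _, _, _ => by cases htag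
  | .storagePost _ _ _, _, _, _ => by cases htag
  | .coerce hr, _, _, h => by
    cases h with
    | coerce h => exact valueTyped_contract_iff.2 (hr.safe hρ hl htag h)
  | .upcast hr, _, _, h => by
    obtain ⟨_, _, rfl, -⟩ := valueTyped_contractAddr_iff.1 (hr.safe hρ hl htag h)
    exact .map (.base .addr)
  | .field hr hC hσ, _, _, h => by
    cases h with
    | field h hv =>
      obtain ⟨_, C', ⟨⟩, hC', o, ho, -, -, hf⟩ :=
        valueTyped_contractAddr_iff.1 (valueTyped_contract_iff.1 (hr.safe hρ hl htag h))
      cases hC.symm.trans hC'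
      obtain ⟨o', ho', hv⟩ := hv
      cases ho.symm.trans ho'
      exact hf _ _ _ hσ hv
  | .index hr he, _, _, h => by
    cases h with
    | index h' h ha =>
      obtain ⟨_, ⟨⟩, hb⟩ := he.safe hρ hl htag .bool h'
      cases valueTyped_map_iff.1 (hr.safe hρ hl htag h) with
      | mapping _ hf => exact .map (hf _ _ hb ha)
  | .env hev, _, _, h => by
    cases h with
    | env h => exact h.safe hρ hl hev

theorem ExprTyped.safe {G : StateTyping} {I : Iface} {Φ : Expr} {A : Option Ident} {tag : Tag}
    {e : Expr} {β : BaseType} {s : State} {ρ : Env} {l : Addr} (hρ : EnvTyped G s ρ I)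
    (hl : LocTyped G s l A) (htag : tag = .U) :
    ExprTyped G I Φ A tag e β → EvalExpr (.U s) ρ l Φ (.bool true) →
      ∀ {v : Value}, EvalExpr (.U s) ρ l e v → ∃ b, v = .base b ∧ BaseTyped b β
  | .int hr, _, _, h => by cases h; exact ⟨_, rfl, .int hr⟩
  | .bool, _, _, h => by cases h; exact ⟨_, rfl, .bool⟩
  | .ref hr, _, _, h => by
    cases h with
    | ref h => exact valueTyped_base_iff.1 (hr.safe hρ hl htag h)
  | .addr hr, _, _, h => by
    cases h with
    | addr h =>
      obtain ⟨_, _, rfl, -⟩ :=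
        valueTyped_contractAddr_iff.1 (valueTyped_contract_iff.1 (hr.safe hρ hl htag h))
      exact ⟨_, rfl, .addr⟩
  | .range _, _, _, h => by cases h <;> exact ⟨_, rfl, .bool⟩
  | .iop _ _ _ hv, hΦ, _, h => hv.inRange hρ hl hΦ h
  | .numConv (ι₂ := ι₂) he hv, hΦ, _, h => by
    by_cases hι : ι₂ = .unbounded
    · subst hι
      obtain ⟨_, rfl, hb⟩ := he.safe hρ hl htag hΦ h
      cases hb
      exact ⟨_, rfl, .int trivial⟩
    · exact (hv hι).inRange hρ hl hΦ h
  | .bop _ _, _, _, h => by cases h; exact ⟨_, rfl, .bool⟩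
  | .not _, _, _, h => by cases h; exact ⟨_, rfl, .bool⟩
  | .cmp _ _, _, _, h => by cases h; exact ⟨_, rfl, .bool⟩
  | .ite _ h₂ h₃, hΦ, _, h => by
    cases h with
    | iteTrue _ h => exact h₂.safe hρ hl htag hΦ h
    | iteFalse _ h => exact h₃.safe hρ hl htag hΦ h
  | .eq _ _, _, _, h => by cases h <;> exact ⟨_, rfl, .bool⟩

end

/-! ### Type safety of mapping expressions -/

theorem IntType.inRange_zero (ι : IntType) : ι.InRange 0 := by
  cases ι with
  | uint M => exact ⟨le_rfl, by linarith [one_le_pow₀ (n := M.val) (one_le_two (α := ℤ))]⟩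
  | sint M =>
    have := one_le_pow₀ (n := M.val - 1) (one_le_two (α := ℤ))
    exact ⟨by linarith, by linarith⟩
  | unbounded => trivial

theorem BaseTyped.inMeta {b : BaseValue} {β : BaseType} (h : BaseTyped b β) : b.InMeta β := by
  cases h <;> trivial

theorem Value.isMap_ofFun (β : BaseType) (f : BaseValue → Value) : (Value.ofFun β f).IsMap β := by
  cases β <;> trivial

theorem Value.app_ofFun {β : BaseType} {b : BaseValue} (f : BaseValue → Value)
    (h : b.InMeta β) : (Value.ofFun β f).app b = some (f b) := by
  cases β <;> cases b <;> first | rfl | cases h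

theorem Value.IsMap.exists_app {β : BaseType} {f : Value} {b : BaseValue} (hf : f.IsMap β)
    (h : b.InMeta β) : ∃ u, f.app b = some u := by
  cases β <;> cases b <;> first | exact h.elim | (cases f <;> first | exact ⟨_, rfl⟩ | exact hf.elim)

theorem mapTyped_ofFun {β : BaseType} {μ : MapType} {f : BaseValue → Value}
    (h : ∀ b, BaseTyped b β → MapTyped (f b) μ) : MapTyped (.ofFun β f) (.mapping β μ) := by
  refine .mapping (Value.isMap_ofFun β f) fun b u hb hu => ?_
  rw [Value.app_ofFun f hb.inMeta] at hu
  cases hu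
  exact h b hb

theorem mapTyped_defaultValue (μ : MapType) : MapTyped (defaultValue μ) μ := by
  induction μ with
  | base β =>
    cases β with
    | int ι => exact .base (.int ι.inRange_zero)
    | bool => exact .base .bool
    | address => exact .base .addr
  | mapping β μ ih => exact mapTyped_ofFun fun _ _ => ih

theorem EvalEntries.typed {st : TState} {ρ : Env} {l : Addr} {kvs : List (Expr × MapExpr)}
    {us : List (BaseValue × Value)} {μ : MapType} (h : EvalEntries st ρ l kvs us)
    (ih : ∀ p ∈ kvs, ∀ v, EvalMap st ρ l p.2 v → MapTyped v μ) {b : BaseValue} {u : Value}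
    (hb : us.lookup b = some u) : MapTyped u μ := by
  induction kvs generalizing us with
  | nil =>
    cases h
    cases hb
  | cons p kvs ihk =>
    cases h with
    | cons _ hm hr =>
      rw [List.lookup_cons] at hb
      split at hb
      · cases hb
        exact ih _ List.mem_cons_self _ hm
      · exact ihk hr (fun p hp => ih p (List.mem_cons_of_mem _ hp)) hb

theorem EvalEntries.typed_getD {st : TState} {ρ : Env} {l : Addr} {kvs : List (Expr × MapExpr)}
    {us : List (BaseValue × Value)} {μ : MapType} (h : EvalEntries st ρ l kvs us)
    (ih : ∀ p ∈ kvs, ∀ v, EvalMap st ρ l p.2 v → MapTyped v μ) (b : BaseValue) {u : Value}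
    (hu : MapTyped u μ) : MapTyped ((us.lookup b).getD u) μ := by
  cases hb : us.lookup b with
  | none => exact hu
  | some v => exact h.typed ih hb

theorem MapExprTyped.safe {G : StateTyping} {I : Iface} {Φ : Expr} {A : Option Ident}
    {m : MapExpr} {μ : MapType} {s : State} {ρ : Env} {l : Addr} (hρ : EnvTyped G s ρ I)
    (hl : LocTyped G s l A) (hΦ : EvalExpr (.U s) ρ l Φ (.bool true))
    (ht : MapExprTyped G I Φ A m μ) : ∀ v, EvalMap (.U s) ρ l m v → MapTyped v μ := by
  induction ht with
  | exp he =>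
    intro v h
    cases h with
    | exp h => exact mapTyped_base_iff.2 (he.safe hρ hl rfl hΦ h)
  | map _ _ ih =>
    intro v h
    cases h with
    | map h => exact mapTyped_ofFun fun b _ => h.typed_getD ih b (mapTyped_defaultValue _)
  | upd hr _ _ ih =>
    intro v h
    cases h with
    | upd hf _ h _ hg =>
      cases valueTyped_map_iff.1 (hr.safe hρ hl rfl hf) with
      | mapping hm hf =>
        refine mapTyped_ofFun fun b hb => ?_
        obtain ⟨u, hu⟩ := hm.exists_app hb.inMeta
        rw [hg b u hu]
        exact h.typed_getD ih b (hf b u hb hu)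

/-! ### Constructor calls -/

mutual

theorem EvalSlot.mono {G G' : StateTyping} (hs : G'.Sub G) {s : State} {ρ : Env} {l : Addr}
    {se : SlotExpr} {v : Value} {s' : State} :
    EvalSlot G' s ρ l se v s' → EvalSlot G s ρ l se v s'
  | .map h => .map h
  | .ref h => .ref h
  | .addr h => .addr (h.mono hs)
  | .new hc hp hn h ho hcs => .new (hs.2.1 _ _ hc) hp hn (h.mono hs) ho (hcs.mono hs)
  | .newPayable hc hp hn h hv ho hcs =>
    .newPayable (hs.2.1 _ _ hc) hp hn (h.mono hs) (hv.mono hs) ho (hcs.mono hs)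

theorem EvalSlots.mono {G G' : StateTyping} (hs : G'.Sub G) {s : State} {ρ : Env} {l : Addr}
    {ses : List SlotExpr} {vs : List Value} {s' : State} :
    EvalSlots G' s ρ l ses vs s' → EvalSlots G s ρ l ses vs s'
  | .nil => .nil
  | .cons h h' => .cons (h.mono hs) (h'.mono hs)

theorem EvalCreates.mono {G G' : StateTyping} (hs : G'.Sub G) {s : State} {ρ : Env}
    {cs : List Create} {A : Ident} {l : Addr} {s' : State} :
    EvalCreates G' s ρ cs A l s' → EvalCreates G s ρ cs A l s'
  | .mk h => .mk (h.mono hs)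

theorem EvalCtorCases.mono {G G' : StateTyping} (hs : G'.Sub G) {s : State} {ρ : Env}
    {cs : List CtorCase} {A : Ident} {l : Addr} {s' : State} :
    EvalCtorCases G' s ρ cs A l s' → EvalCtorCases G s ρ cs A l s'
  | .mk hj hc hn h => .mk hj hc hn (h.mono hs)

end

mutual

theorem EvalSlot.extends {G : StateTyping} {s : State} {ρ : Env} {l : Addr}
    {se : SlotExpr} {v : Value} {s' : State} : EvalSlot G s ρ l se v s' → Extends s s'
  | .map _ => .refl _
  | .ref _ => .refl _
  | .addr h => h.extends
  | .new _ _ _ h _ hcs => h.extends.trans hcs.extends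
  | .newPayable _ _ _ h hv _ hcs => (h.extends.trans hv.extends).trans hcs.extends

theorem EvalSlots.extends {G : StateTyping} {s : State} {ρ : Env} {l : Addr}
    {ses : List SlotExpr} {vs : List Value} {s' : State} :
    EvalSlots G s ρ l ses vs s' → Extends s s'
  | .nil => .refl _
  | .cons h h' => h.extends.trans h'.extends

theorem EvalCreates.extends {G : StateTyping} {s : State} {ρ : Env}
    {cs : List Create} {A : Ident} {l : Addr} {s' : State} :
    EvalCreates G s ρ cs A l s' → Extends s s'
  | .mk h => h.extends.trans (extends_insert_fresh _ _)

theorem EvalCtorCases.extends {G : StateTyping} {s : State} {ρ : Env}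
    {cs : List CtorCase} {A : Ident} {l : Addr} {s' : State} :
    EvalCtorCases G s ρ cs A l s' → Extends s s'
  | .mk _ _ _ h => h.extends

end

theorem assign_forall₂ {V W : Type} {R : V → W → Prop} {vs : List V} {ws : List W}
    (h : List.Forall₂ R vs ws) (xs : List Ident) (x : Ident) :
    Option.Rel R (assign xs vs x) (assign xs ws x) := by
  unfold assign
  induction h generalizing xs with
  | nil => simp
  | cons hR _ ih =>
    cases xs with
    | nil => simp
    | cons y ys =>
      simp only [List.zip_cons_cons, List.lookup_cons]
      split
      · exact .some hR
      · exact ih ys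

theorem exists_iff_of_rel {V W : Type} {R : V → W → Prop} {a : Option V} {b : Option W}
    (h : Option.Rel R a b) : (∃ v, a = some v) ↔ ∃ w, b = some w := by
  cases h <;> simp

theorem rel_of_eq_some {V W : Type} {R : V → W → Prop} {a : Option V} {b : Option W}
    (h : Option.Rel R a b) {v : V} {w : W} (hv : a = some v) (hw : b = some w) : R v w := by
  subst hv hw
  cases h
  assumption

theorem callEnv_typed {G : StateTyping} {s : State} {I : Iface} {bs : List BaseValue}
    {c o w : BaseValue}
    (h : List.Forall₂ (fun v σ => ValueTyped G s v σ) (bs.map .base)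
      (I.map fun p => p.2.toSlot))
    (hc : BaseTyped c .address) (ho : BaseTyped o .address) (hw : BaseTyped w .uint256) :
    EnvTyped G s (callEnv I bs c o w) I := by
  have h' : List.Forall₂ (fun b α => ValueTyped G s (.base b) (ABIType.toSlot α)) bs
      (I.map Prod.snd) := by
    simpa [List.forall₂_map_left_iff, List.forall₂_map_right_iff] using h
  have hI : ∀ x, I.lookup x = assign (I.map Prod.fst) (I.map Prod.snd) x := by
    intro x
    rw [assign, zip_fst_snd]
  refine ⟨fun x => ?_, fun x α b hx hb => ?_, ⟨c, rfl, hc⟩, ⟨o, rfl, ho⟩, ⟨w, rfl, hw⟩⟩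
  · rw [hI]
    exact exists_iff_of_rel (assign_forall₂ h' _ x)
  · rw [hI] at hx
    exact rel_of_eq_some (assign_forall₂ h' _ x) hb hx

theorem argEnv_extends (I : Iface) (bs : List BaseValue) (c o w : BaseValue) :
    EnvExtends (argEnv I bs) (callEnv I bs c o w) := by
  refine ⟨fun _ => rfl, fun k b h => ?_⟩
  cases k with
  | var => exact h
  | _ => cases h

theorem forall₂_of_zip {G : StateTyping} {I I' : Iface} {Φ : Expr} {A : Option Ident}
    {ses : List SlotExpr} (hn : I'.length = ses.length)
    (h : ∀ p ∈ ses.zip I', SlotTyped G I Φ A p.1 p.2.2.toSlot) :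
    List.Forall₂ (SlotTyped G I Φ A) ses (I'.map fun p => p.2.toSlot) := by
  rw [List.forall₂_map_right_iff, List.forall₂_iff_zip]
  exact ⟨hn.symm, fun {a b} hab => h (a, b) hab⟩

/-! ### Type safety of slot expressions -/

mutual

theorem EvalSlot.safe {G : StateTyping} {s : State} {ρ : Env} {l : Addr} {se : SlotExpr}
    {v : Value} {s' : State} :
    EvalSlot G s ρ l se v s' → ∀ {G' : StateTyping} {I : Iface} {Φ : Expr} {A : Option Ident}
      {σ : SlotType}, WellTyped G' → G'.Sub G → EnvTyped G' s ρ I → LocTyped G' s l A →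
      EvalExpr (.U s) ρ l Φ (.bool true) → SlotTyped G' I Φ A se σ →
      ValueTyped G' s' v σ ∧ EvalSlot G' s ρ l se v s'
  | .map h, _, _, _, _, _, _, _, hρ, hl, hΦ, ht => by
    cases ht with
    | map ht => exact ⟨.map (ht.safe hρ hl hΦ _ h), .map h⟩
  | .ref h, _, _, _, _, _, _, _, hρ, hl, hΦ, ht => by
    cases ht with
    | ref ht => exact ⟨ht.safe hρ hl rfl h, .ref h⟩
  | .addr h, _, _, _, _, _, hG', hs, hρ, hl, hΦ, ht => by
    cases ht with
    | addr ht =>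
      obtain ⟨hv, h'⟩ := h.safe hG' hs hρ hl hΦ ht
      exact ⟨valueTyped_contract_iff.1 hv, .addr h'⟩
  | .new hc hp hn h ho hcs, G', _, _, _, _, hG', hs, hρ, hl, hΦ, ht => by
    cases ht with
    | new hc' _ _ hz hpre =>
      cases hc.symm.trans (hs.2.1 _ _ hc')
      obtain ⟨hbs, h'⟩ := h.safe hG' hs hρ hl hΦ (forall₂_of_zip hn hz)
      obtain ⟨o', ho', hto⟩ := hρ.origin
      cases ho.symm.trans ho'
      obtain ⟨G'', C, hG'', hs'', hC, hct⟩ := hG'.ctor hc'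
      obtain ⟨hinst, hcs'⟩ := hcs.safe hG'' (hs''.trans hs) hct rfl
        ((callEnv_typed hbs .addr hto (.int (IntType.inRange_zero _))).restrict hG'' hs''
          hct.iface)
        fun e he => (hpre _ _ _ _ _ hρ hl hΦ h' e he).extend_untimed (.refl _)
          (argEnv_extends _ _ _ _ _)
      obtain ⟨o, ho₁, ho₂, ho₃, ho₄⟩ := hinst
      exact ⟨.contract (.contractAddr ho₁ hC ho₂ ho₃ fun x σ v hx hv => (ho₄ x σ v hx hv).mono hs''),
        .new hc' hp hn h' ho (hcs'.mono hs'')⟩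
  | .newPayable hc hp hn h hw ho hcs, G', _, _, _, _, hG', hs, hρ, hl, hΦ, ht => by
    cases ht with
    | newPayable hc' _ _ hz hval hpre =>
      cases hc.symm.trans (hs.2.1 _ _ hc')
      obtain ⟨hbs, h'⟩ := h.safe hG' hs hρ hl hΦ (forall₂_of_zip hn hz)
      have hext := h.extends
      obtain ⟨hwv, hw'⟩ := hw.safe hG' hs (hρ.imp fun _ _ _ _ hv => hv.extend hext)
        (hl.imp fun _ _ hv => hv.extend hext) (hΦ.extend_untimed hext (.refl _)) hval
      obtain ⟨_, ⟨⟩, hwt⟩ := valueTyped_base_iff.1 hwv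
      have hext' := hw.extends
      obtain ⟨o', ho', hto⟩ := hρ.origin
      cases ho.symm.trans ho'
      obtain ⟨G'', C, hG'', hs'', hC, hct⟩ := hG'.ctor hc'
      obtain ⟨hinst, hcs'⟩ := hcs.safe hG'' (hs''.trans hs) hct rfl
        ((callEnv_typed (hbs.imp fun _ _ hv => hv.extend hext') .addr hto hwt).restrict hG'' hs''
          hct.iface)
        fun e he => (hpre _ _ _ _ _ hρ hl hΦ h' e he).extend_untimed hext'
          (argEnv_extends _ _ _ _ _)
      obtain ⟨o, ho₁, ho₂, ho₃, ho₄⟩ := hinst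
      exact ⟨.contract (.contractAddr ho₁ hC ho₂ ho₃ fun x σ v hx hv => (ho₄ x σ v hx hv).mono hs''),
        .newPayable hc' hp hn h' hw' ho (hcs'.mono hs'')⟩

theorem EvalSlots.safe {G : StateTyping} {s : State} {ρ : Env} {l : Addr} {ses : List SlotExpr}
    {vs : List Value} {s' : State} :
    EvalSlots G s ρ l ses vs s' → ∀ {G' : StateTyping} {I : Iface} {Φ : Expr} {A : Option Ident}
      {σs : List SlotType}, WellTyped G' → G'.Sub G → EnvTyped G' s ρ I → LocTyped G' s l A →
      EvalExpr (.U s) ρ l Φ (.bool true) → List.Forall₂ (SlotTyped G' I Φ A) ses σs →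
      List.Forall₂ (fun v σ => ValueTyped G' s' v σ) vs σs ∧ EvalSlots G' s ρ l ses vs s'
  | .nil, _, _, _, _, _, _, _, _, _, _, ht => by
    cases ht
    exact ⟨.nil, .nil⟩
  | .cons h hr, _, _, _, _, _, hG', hs, hρ, hl, hΦ, ht => by
    cases ht with
    | cons ht htr =>
      obtain ⟨hv, h'⟩ := h.safe hG' hs hρ hl hΦ ht
      have hext := h.extends
      obtain ⟨hvs, hr'⟩ := hr.safe hG' hs (hρ.imp fun _ _ _ _ hv => hv.extend hext)
        (hl.imp fun _ _ hv => hv.extend hext) (hΦ.extend_untimed hext (.refl _)) htr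
      exact ⟨.cons (hv.extend hr.extends) hvs, .cons h' hr'⟩

theorem EvalCreates.safe {G : StateTyping} {s : State} {ρ : Env} {cs : List Create} {A : Ident}
    {l : Addr} {s' : State} :
    EvalCreates G s ρ cs A l s' → ∀ {G' : StateTyping} {I : Iface} {Φ : Expr} {C : Storage},
      WellTyped G' → G'.Sub G → EnvTyped G' s ρ I → EvalExpr (.U s) ρ noLoc Φ (.bool true) →
      CreatesTyped G' I Φ cs C → Instance G' s' l A C ∧ EvalCreates G' s ρ cs A l s'
  | .mk h, _, _, _, _, hG', hs, hρ, hΦ, ⟨_, hC, _, ht⟩ => by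
    obtain ⟨hvs, h'⟩ := h.safe (σs := cs.map Create.type) (A := none) hG' hs hρ trivial hΦ
      (by
        rw [List.forall₂_map_left_iff, List.forall₂_map_right_iff, List.forall₂_same]
        exact ht)
    refine ⟨⟨_, Finmap.lookup_insert _, rfl, fun x => ?_, fun x σ v hx hv => ?_⟩, .mk h'⟩
    · rw [hC]
      exact exists_iff_of_rel (assign_forall₂ hvs _ x)
    · rw [hC] at hx
      exact (rel_of_eq_some (assign_forall₂ hvs _ x) hv hx).extend (extends_insert_fresh _ _)

theorem EvalCtorCases.safe {G : StateTyping} {s : State} {ρ : Env} {cases : List CtorCase}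
    {A : Ident} {l : Addr} {s' : State} :
    EvalCtorCases G s ρ cases A l s' → ∀ {G' : StateTyping} {c : Constructor} {C : Storage},
      WellTyped G' → G'.Sub G → CtorTyped G' A c C → c.cases = cases → EnvTyped G' s ρ c.iface →
      (∀ e ∈ c.pre, EvalExpr (.U s) ρ noLoc e (.bool true)) →
      Instance G' s' l A C ∧ EvalCtorCases G' s ρ cases A l s'
  | .mk hj hc hn h, _, _, _, hG', hs, hct, hcases, hρ, hpre => by
    subst hcases
    obtain ⟨hinst, h'⟩ := h.safe hG' hs hρ (hc.and_true (.conj_true hpre))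
      (hct.creates _ (List.mem_of_getElem? hj))
    exact ⟨hinst, .mk hj hc hn h'⟩

end

/-! ### Updates -/

theorem lookup_setField (s : State) (l l' : Addr) (o : Obj) (x : Ident) (v : Value) :
    (setField s l o x v).lookup l' =
      if l' = l then some ⟨o.type, Function.update o.store x (some v)⟩ else s.lookup l' := by
  unfold setField
  split
  · next h =>
    subst h
    exact Finmap.lookup_insert _
  · next h => exact Finmap.lookup_insert_of_ne _ h

theorem keys_subset_setField (s : State) (l : Addr) (o : Obj) (x : Ident) (v : Value) :
    s.keys ⊆ (setField s l o x v).keys := by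
  intro l' hl'
  rw [Finmap.mem_keys] at hl' ⊢
  exact Finmap.mem_insert.2 (.inr hl')

theorem ValueTyped.known {G : StateTyping} {s : State} {v : Value} {σ : SlotType}
    (h : ValueTyped G s v σ) : σ.Known G := by
  induction h with
  | map => trivial
  | contractAddr _ hC => exact ⟨_, hC⟩
  | contract _ ih => exact ih

/-- Writing a value of the declared type to a field preserves value typing. -/
theorem ValueTyped.setField {G : StateTyping} (hG : WellTyped G) {s : State} {l : Addr} {o : Obj}
    {x : Ident} {v : Value} {B : Ident} {C : Storage} {τ : SlotType}
    (hl : ValueTyped G s (.base (.addr l)) (.contract B)) (hC : G.storage B = some C)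
    (hx : C x = some τ) (hv : ValueTyped G s v τ) (ho : s.lookup l = some o)
    {u : Value} {σ : SlotType} (hu : ValueTyped G s u σ) :
    ValueTyped G (setField s l o x v) u σ := by
  obtain ⟨_, _, ⟨⟩, hC', o', ho', hB, -, -⟩ :=
    valueTyped_contractAddr_iff.1 (valueTyped_contract_iff.1 hl)
  cases hC.symm.trans hC'
  cases ho.symm.trans ho'
  clear ho' hC'
  suffices H : ∀ u, ValueTyped G s u σ → ValueTyped G (Act.setField s l o x v) u σ from H u hu
  refine hG.known_induction (P := fun σ => ∀ u, ValueTyped G s u σ →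
    ValueTyped G (Act.setField s l o x v) u σ) ?_ ?_ ?_ hu.known
  · intro μ u hu
    exact .map (valueTyped_map_iff.1 hu)
  · intro A D hD ih u hu
    obtain ⟨l', D', rfl, hD', o', ho', hA, hd, hf⟩ := valueTyped_contractAddr_iff.1 hu
    cases hD.symm.trans hD'
    by_cases e : l' = l
    · subst e
      cases ho.symm.trans ho'
      cases hB.symm.trans hA
      cases hC.symm.trans hD
      refine .contractAddr (o := ⟨o.type, Function.update o.store x (some v)⟩)
        (by rw [lookup_setField, if_pos rfl]) hC hB (fun y => ?_) fun y σ w hy hw => ?_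
      · by_cases e : y = x
        · subst e
          simp [hx]
        · simpa [Function.update_of_ne e] using hd y
      · refine ih y σ hy w ?_
        by_cases e : y = x
        · subst e
          cases hx.symm.trans hy
          have hw' : some v = some w := by simpa using hw
          cases hw'
          exact hv
        · exact hf y σ w hy (by simpa [Function.update_of_ne e] using hw)
    · exact .contractAddr (by rw [lookup_setField, if_neg e, ho']) hD hA hd fun y σ w hy hw =>
        ih y σ hy w (hf y σ w hy hw)
  · intro A ih u hu
    exact valueTyped_contract_iff.2 (ih u (valueTyped_contract_iff.1 hu))

/-- A reference of kind `S` starts at a storage field of the current contract. -/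
theorem RefTyped.declared {G : StateTyping} {I : Iface} {A : Ident} :
    ∀ {r : Ref} {σ : SlotType}, RefTyped G I .S (some A) .U r σ → ∃ C, G.storage A = some C
  | .var _, _, h => by cases h with | storage hC => exact ⟨_, hC⟩
  | .field _ _, _, h => by cases h with | field hr => exact hr.declared
  | .pre _, _, h => by cases h
  | .post _, _, h => by cases h
  | .coerce _ _, _, h => by cases h
  | .index _ _, _, h => by cases h
  | .env _, _, h => by cases h

/-- Value typing and the domain of the state persist from `s` to `s'`. -/
def Persists (G : StateTyping) (s s' : State) : Prop :=
  (∀ v σ, ValueTyped G s v σ → ValueTyped G s' v σ) ∧ s.keys ⊆ s'.keys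

theorem Persists.trans {G : StateTyping} {s₁ s₂ s₃ : State} (h : Persists G s₁ s₂)
    (h' : Persists G s₂ s₃) : Persists G s₁ s₃ :=
  ⟨fun v σ hv => h'.1 v σ (h.1 v σ hv), h.2.trans h'.2⟩

theorem Persists.refl (G : StateTyping) (s : State) : Persists G s s := ⟨fun _ _ h => h, subset_rfl⟩

theorem Extends.persists {s s' : State} (h : Extends s s') (G : StateTyping) : Persists G s s' :=
  ⟨fun _ _ hv => hv.extend h, h.keys_subset⟩

theorem Ins.persists {G G' : StateTyping} (hG : WellTyped G) (hs : G'.Sub G) {I : Iface}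
    {A : Ident} {s s' : State} {ρ : Env} {l : Addr} {r : Ref} {v : Value} {σ : SlotType}
    (hρ : EnvTyped G' s ρ I) (hl : ValueTyped G' s (.base (.addr l)) (.contract A))
    (ht : RefTyped G' I .S (some A) .U r σ) (hv : ValueTyped G' s v σ) (h : Ins s ρ l r v s') :
    Persists G s s' := by
  cases h with
  | storage ho _ =>
    cases ht with
    | storage hC hx =>
      exact ⟨fun u τ hu => .setField hG (hl.mono hs) (hs.1 _ _ hC) hx (hv.mono hs) ho hu,
        keys_subset_setField _ _ _ _ _⟩
  | field hr ho _ =>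
    cases ht with
    | field htr hC hx =>
      have hl' := htr.safe hρ (A := some A) hl rfl hr
      exact ⟨fun u τ hu => .setField hG (hl'.mono hs) (hs.1 _ _ hC) hx (hv.mono hs) ho hu,
        keys_subset_setField _ _ _ _ _⟩

theorem InsAll.persists {G G' : StateTyping} (hG : WellTyped G) (hG' : WellTyped G')
    (hs : G'.Sub G) {I : Iface} {A : Ident} {s s' : State} {ρ : Env} {l : Addr}
    {us : List Update} {vs : List Value} (hρ : EnvTyped G' s ρ I)
    (hl : ValueTyped G' s (.base (.addr l)) (.contract A))
    (ht : ∀ u ∈ us, RefTyped G' I .S (some A) .U u.ref u.type)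
    (hv : List.Forall₂ (fun v σ => ValueTyped G' s v σ) vs (us.map Update.type))
    (h : InsAll s ρ l (us.map Update.ref) vs s') : Persists G s s' := by
  induction us generalizing s vs with
  | nil =>
    cases h
    exact .refl G _
  | cons u us ih =>
    cases hv with
    | cons hv hvs =>
      cases h with
      | cons h hr =>
        have hu := ht u List.mem_cons_self
        have hp := (h.persists hG' (.refl G') hρ hl hu hv).1
        exact (h.persists hG hs hρ hl hu hv).trans
          (ih (hρ.imp fun _ _ _ _ h => hp _ _ h) (hp _ _ hl)
            (fun u hu => ht u (List.mem_cons_of_mem _ hu)) (hvs.imp fun _ _ h => hp _ _ h) hr)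

theorem WellTyped.trans_typed {G : StateTyping} (hG : WellTyped G) {A : Ident}
    {ts : List Transition} (hts : G.trans A = some ts) :
    ∃ G', WellTyped G' ∧ G'.Sub G ∧ ∀ t ∈ ts, TransTyped G' A t := by
  cases hG with
  | mk w w' _ _ _ _ h₁ h₂ h₃ => exact ⟨w' A, h₂ A ts hts, (h₁ A ts hts).1, h₃ A ts hts⟩

theorem StepTrans.persists {G : StateTyping} (hG : WellTyped G) {A : Ident} {l : Addr}
    {s s' : State} (h : StepTrans G A l s s') : Persists G s s' := by
  obtain ⟨ρ, ts, t, v, hl, hts, ht, hρ, hpre, j, k, hj, hk, -, ⟨vs, sₙ, hslots, hins⟩, -⟩ := h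
  obtain ⟨G', hG', hs, htt⟩ := hG.trans_typed hts
  replace ht := htt t ht
  have hu := (ht.updates k (List.mem_of_getElem? hj)).1
  by_cases hA : ∃ C, G'.storage A = some C
  · replace hl : ValueTyped G' s (.base (.addr l)) (.contract A) := hl.restrict hG' hs hA
    replace hρ := hρ.restrict hG' hs ht.iface
    have hext := hslots.extends
    obtain ⟨hvs, -⟩ := hslots.safe (A := some A) (σs := k.updates.map Update.type) hG' hs hρ hl
      (hk.and_true (.conj_true hpre))
      (by
        rw [List.forall₂_map_left_iff, List.forall₂_map_right_iff, List.forall₂_same]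
        exact fun u h => (hu u h).2)
    exact (hext.persists G).trans
      (hins.persists hG hG' hs (hρ.imp fun _ _ _ _ h => h.extend hext) (hl.extend hext)
        (fun u h => (hu u h).1) hvs)
  · have hnil : k.updates = [] :=
      List.eq_nil_iff_forall_not_mem.2 fun u h => hA (hu u h).1.declared
    rw [hnil] at hslots hins
    cases hslots
    cases hins
    exact .refl G s

theorem Step.persists {G : StateTyping} (hG : WellTyped G) {s s' : State} (h : Step G s s') :
    Persists G s s' := by
  rcases h with ⟨A, l, ρ, c, -, -, -, h⟩ | ⟨A, l, h⟩
  · exact h.extends.persists G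
  · exact h.persists hG

end Act

theorem mainTheorem2 (G : Act.StateTyping) (hG : Act.WellTyped G) (s s' : Act.State)
    (h : Act.Steps G s s') :
    (∀ (v : Act.Value) (σ : Act.SlotType), Act.ValueTyped G s v σ → Act.ValueTyped G s' v σ) ∧
      s.keys ⊆ s'.keys := by
  induction h with
  | refl => exact Act.Persists.refl G s
  | tail _ h ih => exact Act.Persists.trans ih (h.persists hG)
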